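/- Let $S$ be a finite set of (colored) steps, each of which is of type $\nearrow$ (height change $+1$), $\searrow$ (height change $-1$) or $\rightarrow$ (height change $0$), and assume that the numbers of $\nearrow$ steps and of $\searrow$ steps in $S$ are equal and positive (the number of $\rightarrow$ steps is arbitrary, possibly $0$). The Florentine algorithm with target size $n$ builds a path, starting from the empty path at height $0$, by appending independent uniformly random steps of $S$ one at a time. Whenever the path steps below its origin, it is discarded and the algorithm starts over from the empty path; as soon as the current path has length $n$, the algorithm stops and outputs it (a prefix of a colored Motzkin path). Let $Y_n$ be the total number of steps drawn by the algorithm, including those of the discarded paths. For $0<\alpha<1$, the Darling–Mandelbrot distribution of parameter $\alpha$ is the probability distribution supported on $[0,\infty)$ with characteristic function $$\phi_\alpha(s)=\Bigl(1-\sum_{k=1}^\infty\frac{\alpha}{k-\alpha}\,\frac{(is)^k}{k!}\Bigr)^{-1},$$ and $\mathcal D(\alpha)$ denotes this distribution shifted by one, with characteristic function $e^{is}\phi_\alpha(s)$. Then the algorithm terminates almost surely, the law $\mathcal D(\frac12)$ exists, and, as $n\to\infty$, the random variable $Y_n/n$ converges in distribution to $\mathcal D(\frac12)$. Moreover $Y_n$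 has a finite second moment for every $n$, and $$\mathbb E(Y_n)\sim 2n,\qquad \mathbb V(Y_n)\sim\tfrac43\,n^2.$$ -/

import Mathlib

open MeasureTheory ProbabilityTheory Filter Topology
open scoped ENNReal Asymptotics

/-- The three kinds of steps of a Motzkin path. -/
inductive MotzkinKind where
  | up
  | down
  | level
  deriving DecidableEq

/-- The vertical displacement of a step: `+1`, `-1` or `0`. -/
def MotzkinKind.rise : MotzkinKind → ℤ
  | .up => 1
  | .down => -1
  | .level => 0

section Florentine

variable {S : Type*} (kind : S → MotzkinKind)

/-- The final height, relative to the origin, of a path with steps in `S`, where the (coloured)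
step `s` is of the kind `kind s`. -/
def pathHeight (p : List S) : ℤ := (p.map fun s => (kind s).rise).sum

/-- The path held by the Florentine algorithm after it has drawn the steps `w 0, …, w (m - 1)`.
Each drawn step is appended to the current path; if the path thereby steps below the origin, it is
thrown away and the algorithm starts over from the empty path. -/
def florentinePath (w : ℕ → S) : ℕ → List S
  | 0 => []
  | m + 1 =>
    if 0 ≤ pathHeight kind (florentinePath w m ++ [w m]) then florentinePath w m ++ [w m] else []

/-- The Florentine algorithm with target size `n`, fed with the steps `w`, terminates. -/
def FlorentineTerminates (w : ℕ → S) (n : ℕ) : Prop :=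
  ∃ m, (florentinePath kind w m).length = n

/-- The number of steps drawn by the Florentine algorithm with target size `n`, which stops as soon
as its current path has length `n` (with the value `0` if it never stops). -/
noncomputable def florentineCost (w : ℕ → S) (n : ℕ) : ℕ :=
  sInf {m | (florentinePath kind w m).length = n}

end Florentine

/-- The function `φ_α(s) = (1 - ∑_{n ≥ 1} α / (n - α) * (i s)^n / n!)⁻¹`. -/
noncomputable def darlingMandelbrotCharFun (α s : ℝ) : ℂ :=
  (1 - ∑' n : ℕ, (α : ℂ) / (((n + 1 : ℕ) : ℂ) - α) *
    ((Complex.I * s) ^ (n + 1) / ((n + 1).factorial : ℂ)))⁻¹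

/-- `μ` is the Darling–Mandelbrot distribution of parameter `α`: it is supported on `[0, ∞)` and
has the characteristic function `φ_α`. -/
structure IsDarlingMandelbrot (α : ℝ) (μ : ProbabilityMeasure ℝ) : Prop where
  support_nonneg : (μ : Measure ℝ) (Set.Iio 0) = 0
  charFun_eq : ∀ s : ℝ, charFun (μ : Measure ℝ) s = darlingMandelbrotCharFun α s

/-- `ν` is the law `𝒟(α)`, the Darling–Mandelbrot distribution of parameter `α` shifted by one. -/
def IsShiftedDarlingMandelbrot (α : ℝ) (ν : ProbabilityMeasure ℝ) : Prop :=
  ∃ μ : ProbabilityMeasure ℝ, IsDarlingMandelbrot α μ ∧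
    (ν : Measure ℝ) = (μ : Measure ℝ).map fun x => x + 1

/-! Let `q k` be the probability that the walk stays nonnegative for `k` steps. A run either reaches
length `n`, with probability `q n`, or first fails at step `k + 1 ≤ n`, with probability `q k - q (k
+ 1)`; after a failure everything restarts independently. So the law of the cost solves a renewal
equation (`map_florentineCost_eq`). Testing it against `x`, `x ^ 2` and `exp (i t x)` gives the
mean, the variance and the characteristic function in terms of the sums `∑ k < n, (q k - q (k + 1))
(k + 1) ^ j / q n`. Almost sure termination is similar: the probability `x` of never stopping
satisfies `x = (1 - q n) x`.

The only analytic input is `q n ~ c / √n` with `c > 0`. Abel summation then shows that the `j`-th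
sum, divided by `n ^ j`, tends to `1 / (2 j - 1) = α / (j - α)` with `α = 1 / 2`: these are the
coefficients of `φ_α` (`tendsto_truncated_moment`, `tendsto_truncated_charFun`). The cases `j = 1,
2` give mean `n (1 + 1)` and variance `n ^ 2 (1 + 1 / 3)` asymptotically.

The decay of `q` comes from diagonalising the walk killed at `-1`: `survival_eq_integral` writes the
survival probability as a cosine integral, and Laplace's method at `t = 0` evaluates it. Finally, a
limit of characteristic functions that is continuous at `0` yields both the existence of the
Darling–Mandelbrot law and the weak convergence to it. -/

/-! ### Truncated moments of a tail of order `n ^ (-1 / 2)` -/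

/-- By homogeneity this is the slope of `x ^ r` at `1` with increment `1 / k`. -/
theorem tendsto_rpow_succ_sub_rpow_div (r : ℝ) :
    Tendsto (fun k : ℕ => (((k : ℝ) + 1) ^ r - (k : ℝ) ^ r) / (k : ℝ) ^ (r - 1)) atTop (𝓝 r) := by
  have hd : HasDerivAt (fun x : ℝ => x ^ r) r 1 := by
    simpa using Real.hasDerivAt_rpow_const (x := 1) (p := r) (Or.inl one_ne_zero)
  have hs := hd.tendsto_slope_zero
  have hk : Tendsto (fun k : ℕ => (k : ℝ)⁻¹) atTop (𝓝[≠] 0) := by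
    refine tendsto_nhdsWithin_iff.2 ⟨tendsto_inv_atTop_nhds_zero_nat, ?_⟩
    filter_upwards [eventually_gt_atTop 0] with k hk
    simp [hk.ne']
  refine (hs.comp hk).congr' ?_
  filter_upwards [eventually_gt_atTop 0] with k hk
  have hk' : (0 : ℝ) < k := by exact_mod_cast hk
  have h1 : (k : ℝ) + 1 = k * (1 + (k : ℝ)⁻¹) := by field_simp
  simp only [Function.comp, inv_inv, smul_eq_mul, Real.one_rpow]
  rw [h1, Real.mul_rpow hk'.le (by positivity), Real.rpow_sub_one hk'.ne']
  have : (k : ℝ) ^ r ≠ 0 := (Real.rpow_pos_of_pos hk' r).ne'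
  field_simp

/-- Abel summation; `j ≠ 0` kills the boundary term at `0`. -/
theorem sum_range_sub_mul_pow (q : ℕ → ℝ) {j : ℕ} (hj : j ≠ 0) (n : ℕ) :
    ∑ k ∈ Finset.range n, (q k - q (k + 1)) * ((k : ℝ) + 1) ^ j =
      ∑ k ∈ Finset.range n, q k * (((k : ℝ) + 1) ^ j - (k : ℝ) ^ j) - q n * (n : ℝ) ^ j := by
  induction n with
  | zero => simp [hj]
  | succ n ih =>
    rw [Finset.sum_range_succ, Finset.sum_range_succ, ih]
    push_cast
    ring

/-- Truncated moments of a distribution whose tail `q` decays like `c / √n`. -/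
theorem tendsto_truncated_moment {q : ℕ → ℝ} {c : ℝ} (hc : 0 < c)
    (hq : Tendsto (fun n : ℕ => √(n : ℝ) * q n) atTop (𝓝 c)) {j : ℕ} (hj : j ≠ 0) :
    Tendsto (fun n : ℕ =>
      (∑ k ∈ Finset.range n, (q k - q (k + 1)) * (((k : ℝ) + 1) / n) ^ j) / q n)
      atTop (𝓝 (1 / (2 * j - 1))) := by
  have hj1 : (1 : ℝ) ≤ j := by exact_mod_cast Nat.one_le_iff_ne_zero.2 hj
  -- After Abel summation the terms `a k` are of order `c * j * k ^ (r - 1)`, hence asymptotic to `c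
  -- * j / r` times the increment `b k` of `k ^ r`.
  set r : ℝ := j - 1 / 2 with hr
  have hr0 : 0 < r := by rw [hr]; linarith
  set b : ℕ → ℝ := fun k => ((k : ℝ) + 1) ^ r - (k : ℝ) ^ r with hb
  set a : ℕ → ℝ := fun k => q k * (((k : ℝ) + 1) ^ j - (k : ℝ) ^ j) with ha
  have hbpos : ∀ k, 0 < b k := fun k =>
    sub_pos.2 (Real.rpow_lt_rpow (Nat.cast_nonneg k) (lt_add_one _) hr0)
  have hbsum : ∀ n, ∑ k ∈ Finset.range n, b k = (n : ℝ) ^ r := by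
    intro n
    have := Finset.sum_range_sub (fun k : ℕ => (k : ℝ) ^ r) n
    simpa [hb, Real.zero_rpow hr0.ne'] using this
  set l : ℝ := c * j / r with hl
  have hratio : Tendsto (fun k => a k / b k) atTop (𝓝 l) := by
    have h1 := tendsto_rpow_succ_sub_rpow_div (j : ℝ)
    have h2 := tendsto_rpow_succ_sub_rpow_div r
    refine ((hq.mul h1).div h2 hr0.ne').congr' ?_
    filter_upwards [eventually_gt_atTop 0] with k hk
    have hk' : (0 : ℝ) < k := by exact_mod_cast hk
    have hb0 : ((k : ℝ) + 1) ^ r - (k : ℝ) ^ r ≠ 0 := (hbpos k).ne'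
    have e1 : (k : ℝ) ^ (r - 1) * √(k : ℝ) = (k : ℝ) ^ ((j : ℝ) - 1) := by
      rw [Real.sqrt_eq_rpow, ← Real.rpow_add hk', hr]; congr 1; ring
    have e2 : (k : ℝ) ^ (r - 1) ≠ 0 := (Real.rpow_pos_of_pos hk' _).ne'
    have e3 : √(k : ℝ) ≠ 0 := (Real.sqrt_pos.2 hk').ne'
    simp only [Pi.div_apply, ha, hb, ← Real.rpow_natCast]
    rw [← e1]
    field_simp
  have hlo : (fun k => a k - l * b k) =o[atTop] b := by
    rw [Asymptotics.isLittleO_iff_tendsto' (Eventually.of_forall fun k h => absurd h (hbpos k).ne')]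
    have := hratio.sub_const l
    rw [sub_self] at this
    refine this.congr fun k => ?_
    have := (hbpos k).ne'
    field_simp
  have hnr : Tendsto (fun n : ℕ => (n : ℝ) ^ r) atTop atTop :=
    (tendsto_rpow_atTop hr0).comp tendsto_natCast_atTop_atTop
  -- Stolz–Cesàro: the termwise comparison passes to partial sums because those of `b` diverge.
  have hsum := hlo.sum_range (fun k => (hbpos k).le) (by simpa only [hbsum] using hnr)
  simp only [hbsum, Finset.sum_sub_distrib, ← Finset.mul_sum] at hsum
  have hA : Tendsto (fun n : ℕ => (∑ k ∈ Finset.range n, a k) / (n : ℝ) ^ r) atTop (𝓝 l) := by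
    have := hsum.tendsto_div_nhds_zero.add_const l
    rw [zero_add] at this
    refine this.congr' ?_
    filter_upwards [eventually_gt_atTop 0] with k hk
    have hk' : (0 : ℝ) < k := by exact_mod_cast hk
    have := (Real.rpow_pos_of_pos hk' r).ne'
    field_simp
    ring
  have hfin := (hA.div hq hc.ne').sub_const 1
  -- The `-1` is the boundary term `q n * n ^ j` of the Abel summation.
  have hval : l / c - 1 = 1 / (2 * j - 1) := by
    obtain ⟨d, hd⟩ : ∃ d : ℝ, d = 2 * j - 1 := ⟨_, rfl⟩
    have hd0 : d ≠ 0 := by rw [hd]; linarith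
    have h2 : r = d / 2 := by rw [hr, hd]; ring
    have h3 : (j : ℝ) = (d + 1) / 2 := by rw [hd]; ring
    rw [hl, h2, ← hd, h3]
    field_simp
    ring
  rw [hval] at hfin
  refine hfin.congr' ?_
  filter_upwards [eventually_gt_atTop 0, hq.eventually_ne hc.ne'] with n hn hqn
  have hn' : (0 : ℝ) < n := by exact_mod_cast hn
  have hq0 : q n ≠ 0 := fun h => hqn (by rw [h, mul_zero])
  have e1 : (n : ℝ) ^ r * √(n : ℝ) = (n : ℝ) ^ j := by
    rw [Real.sqrt_eq_rpow, ← Real.rpow_add hn', hr, ← Real.rpow_natCast]; congr 1; ring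
  have e2 : (n : ℝ) ^ r ≠ 0 := (Real.rpow_pos_of_pos hn' _).ne'
  have e3 : √(n : ℝ) ≠ 0 := (Real.sqrt_pos.2 hn').ne'
  have e4 := sum_range_sub_mul_pow q hj n
  simp only [Pi.div_apply, div_pow, mul_div_assoc', ← Finset.sum_div, e4, ha]
  rw [div_div]
  rw [show ∀ x : ℝ, x / ((n : ℝ) ^ r * (√(n : ℝ) * q n)) = x / ((n : ℝ) ^ j * q n) from
    fun x => by rw [← mul_assoc, e1]]
  have e5 : (n : ℝ) ^ j ≠ 0 := by positivity
  field_simp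

theorem hasSum_exp_sub_one (z : ℂ) :
    HasSum (fun j : ℕ => z ^ (j + 1) / ((j + 1).factorial : ℂ)) (Complex.exp z - 1) := by
  have h := NormedSpace.expSeries_div_hasSum_exp z
  rw [← Complex.exp_eq_exp_ℂ] at h
  simpa using (hasSum_nat_add_iff' 1).2 h

/-- Expand the exponential, so that the truncated moments become the coefficients of a power series
in `i s`, and pass to the limit termwise. Since `(k + 1) / n ≤ 1`, every moment is at most the first
one, which tends to `1` and so is eventually below `2`: this dominates the series. -/
theorem tendsto_truncated_charFun {q : ℕ → ℝ} {c : ℝ} (hc : 0 < c)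
    (hq : Tendsto (fun n : ℕ => √(n : ℝ) * q n) atTop (𝓝 c)) (hpos : ∀ n, 0 < q n)
    (hanti : Antitone q) (s : ℝ) :
    Tendsto (fun n : ℕ => 1 - (∑ k ∈ Finset.range n, ((q k - q (k + 1) : ℝ) : ℂ) *
      (Complex.exp (Complex.I * s * (((k : ℝ) + 1) / n : ℝ)) - 1)) / (q n : ℂ)) atTop
      (𝓝 (1 - ∑' n : ℕ, ((1 / 2 : ℝ) : ℂ) / (((n + 1 : ℕ) : ℂ) - ((1 / 2 : ℝ) : ℂ)) *
        ((Complex.I * s) ^ (n + 1) / ((n + 1).factorial : ℂ)))) := by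
  refine tendsto_const_nhds.sub ?_
  set M : ℕ → ℕ → ℝ := fun j n =>
    (∑ k ∈ Finset.range n, (q k - q (k + 1)) * (((k : ℝ) + 1) / n) ^ j) / q n with hM
  have hw : ∀ k, 0 ≤ q k - q (k + 1) := fun k => sub_nonneg.2 (hanti k.le_succ)
  have hM0 : ∀ j n, 0 ≤ M j n := fun j n =>
    div_nonneg (Finset.sum_nonneg fun k _ => mul_nonneg (hw k) (by positivity)) (hpos n).le
  have hM1 : ∀ j n, M (j + 1) n ≤ M 1 n := by
    intro j n
    refine div_le_div_of_nonneg_right (Finset.sum_le_sum fun k hk => ?_) (hpos n).le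
    refine mul_le_mul_of_nonneg_left ?_ (hw k)
    refine pow_le_pow_of_le_one (by positivity) ?_ (Nat.le_add_left 1 j)
    have hk' : ((k + 1 : ℕ) : ℝ) ≤ n := by exact_mod_cast Finset.mem_range.1 hk
    exact div_le_one_of_le₀ (by exact_mod_cast hk') (Nat.cast_nonneg n)
  have hser : ∀ n : ℕ, (∑ k ∈ Finset.range n, ((q k - q (k + 1) : ℝ) : ℂ) *
      (Complex.exp (Complex.I * s * (((k : ℝ) + 1) / n : ℝ)) - 1)) / (q n : ℂ) =
      ∑' j : ℕ, (M (j + 1) n : ℂ) * ((Complex.I * s) ^ (j + 1) / ((j + 1).factorial : ℂ)) := by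
    intro n
    have h1 := (hasSum_sum (s := Finset.range n) fun k _ =>
      (hasSum_exp_sub_one (Complex.I * s * (((k : ℝ) + 1) / n : ℝ))).mul_left
        ((q k - q (k + 1) : ℝ) : ℂ)).div_const (q n : ℂ)
    rw [← h1.tsum_eq]
    refine tsum_congr fun j => ?_
    simp only [hM]
    push_cast
    rw [Finset.sum_div, Finset.sum_div, Finset.sum_mul]
    refine Finset.sum_congr rfl fun k _ => ?_
    rw [mul_pow (Complex.I * s)]
    ring
  simp only [hser]
  refine tendsto_tsum_of_dominated_convergence
    (bound := fun j => 2 * (|s| ^ (j + 1) / ((j + 1).factorial : ℝ))) ?_ ?_ ?_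
  · exact ((summable_nat_add_iff 1).2 (Real.summable_pow_div_factorial |s|)).mul_left 2
  · intro j
    refine Tendsto.mul_const _ ?_
    have h := tendsto_truncated_moment hc hq j.succ_ne_zero
    have h2 := (Complex.continuous_ofReal.tendsto _).comp h
    have h3 : (1 / (2 * ((j + 1 : ℕ) : ℝ) - 1) : ℝ) = (1 / 2) / (((j + 1 : ℕ) : ℝ) - 1 / 2) := by
      have h4 : ((j + 1 : ℕ) : ℝ) - 1 / 2 ≠ 0 := by
        push_cast
        have := j.cast_nonneg (α := ℝ)
        linarith
      rw [show 2 * ((j + 1 : ℕ) : ℝ) - 1 = 2 * (((j + 1 : ℕ) : ℝ) - 1 / 2) by ring]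
      field_simp
    rw [h3] at h2
    have h5 : (((1 / 2) / (((j + 1 : ℕ) : ℝ) - 1 / 2) : ℝ) : ℂ) =
        ((1 / 2 : ℝ) : ℂ) / (((j + 1 : ℕ) : ℂ) - ((1 / 2 : ℝ) : ℂ)) := by
      push_cast
      rfl
    rw [← h5]
    exact h2
  · have h1 : ∀ᶠ n in atTop, M 1 n ≤ 2 := by
      have h := tendsto_truncated_moment hc hq one_ne_zero
      exact (h.eventually_lt_const (u := 2) (by norm_num)).mono fun n hn => hn.le
    filter_upwards [h1] with n hn j
    rw [norm_mul, norm_div, norm_pow, norm_mul, Complex.norm_I, one_mul, Complex.norm_real,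
      Complex.norm_real, Complex.norm_natCast, Real.norm_eq_abs s, Real.norm_of_nonneg (hM0 _ _)]
    exact mul_le_mul_of_nonneg_right ((hM1 j n).trans hn) (by positivity)

/-! ### Survival probability as a Fourier integral -/

/-- The kernel `1 + 2 ∑_{1 ≤ j ≤ h} cos (j t) + cos ((h + 1) t) = sin ((h + 1) t) cot (t / 2)`. -/
noncomputable def survivalKernel : ℕ → ℝ → ℝ
  | 0, t => 1 + Real.cos t
  | h + 1, t => survivalKernel h t + Real.cos ((h + 1 : ℕ) * t) + Real.cos ((h + 2 : ℕ) * t)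

theorem continuous_survivalKernel (h : ℕ) : Continuous (survivalKernel h) := by
  induction h with
  | zero => exact continuous_const.add Real.continuous_cos
  | succ h ih =>
    exact (ih.add (Real.continuous_cos.comp (continuous_const.mul continuous_id))).add
      (Real.continuous_cos.comp (continuous_const.mul continuous_id))

theorem two_mul_cos_mul_cos (x t : ℝ) :
    2 * Real.cos t * Real.cos x = Real.cos (x + t) + Real.cos (x - t) := by
  rw [Real.cos_add, Real.cos_sub]
  ring

/-- The eigenvalue relation at height `0`: the kernel would vanish at height `-1`, where the walk is
killed. -/
theorem two_mul_cos_mul_survivalKernel_zero (t : ℝ) :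
    2 * Real.cos t * survivalKernel 0 t = survivalKernel 1 t := by
  simp only [survivalKernel]
  have h := two_mul_cos_mul_cos t t
  rw [show t + t = ((0 + 2 : ℕ) : ℝ) * t by push_cast; ring, sub_self, Real.cos_zero] at h
  rw [show ((0 + 1 : ℕ) : ℝ) * t = t by push_cast; ring]
  linear_combination h

theorem two_mul_cos_mul_survivalKernel_succ (h : ℕ) (t : ℝ) :
    2 * Real.cos t * survivalKernel (h + 1) t =
      survivalKernel (h + 2) t + survivalKernel h t := by
  induction h with
  | zero =>
    have h0 := two_mul_cos_mul_survivalKernel_zero t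
    have h1 := two_mul_cos_mul_cos (((0 + 1 : ℕ) : ℝ) * t) t
    have h2 := two_mul_cos_mul_cos (((0 + 2 : ℕ) : ℝ) * t) t
    rw [show ((0 + 1 : ℕ) : ℝ) * t + t = ((0 + 2 : ℕ) : ℝ) * t by push_cast; ring,
      show ((0 + 1 : ℕ) : ℝ) * t - t = 0 by push_cast; ring, Real.cos_zero] at h1
    rw [show ((0 + 2 : ℕ) : ℝ) * t + t = ((0 + 1 + 2 : ℕ) : ℝ) * t by push_cast; ring,
      show ((0 + 2 : ℕ) : ℝ) * t - t = t by push_cast; ring] at h2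
    simp only [survivalKernel] at h0 ⊢
    linear_combination h0 + h1 + h2
  | succ h ih =>
    have h1 := two_mul_cos_mul_cos (((h + 1 + 1 : ℕ) : ℝ) * t) t
    have h2 := two_mul_cos_mul_cos (((h + 1 + 2 : ℕ) : ℝ) * t) t
    rw [show ((h + 1 + 1 : ℕ) : ℝ) * t + t = ((h + 1 + 2 : ℕ) : ℝ) * t by push_cast; ring,
      show ((h + 1 + 1 : ℕ) : ℝ) * t - t = ((h + 1 : ℕ) : ℝ) * t by push_cast; ring] at h1
    rw [show ((h + 1 + 2 : ℕ) : ℝ) * t + t = ((h + 1 + 1 + 2 : ℕ) : ℝ) * t by push_cast; ring,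
      show ((h + 1 + 2 : ℕ) : ℝ) * t - t = ((h + 2 : ℕ) : ℝ) * t by push_cast; ring] at h2
    simp only [survivalKernel] at ih h1 h2 ⊢
    rw [show ((h + 1 + 1 + 1 : ℕ) : ℝ) = ((h + 1 + 2 : ℕ) : ℝ) from rfl,
      show ((h + 1 + 1 : ℕ) : ℝ) = ((h + 2 : ℕ) : ℝ) from rfl]
    rw [show ((h + 1 + 1 : ℕ) : ℝ) = ((h + 2 : ℕ) : ℝ) from rfl] at ih h1
    linear_combination ih + h1 + h2

theorem integral_cos_nat_mul {m : ℕ} (hm : m ≠ 0) :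
    ∫ t in (0 : ℝ)..Real.pi, Real.cos (m * t) = 0 := by
  have hm' : (m : ℝ) ≠ 0 := by exact_mod_cast hm
  rw [intervalIntegral.integral_comp_mul_left (fun x => Real.cos x) hm', integral_cos]
  simp [Real.sin_nat_mul_pi]

/-- Only the constant term of the cosine sum survives. This encodes the initial condition `U 0 h =
1`. -/
theorem integral_survivalKernel (h : ℕ) :
    ∫ t in (0 : ℝ)..Real.pi, survivalKernel h t = Real.pi := by
  have hc : ∀ m : ℕ, IntervalIntegrable (fun t => Real.cos (m * t)) volume 0 Real.pi := fun m =>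
    (Real.continuous_cos.comp (continuous_const.mul continuous_id)).intervalIntegrable _ _
  induction h with
  | zero =>
    simp only [survivalKernel]
    rw [intervalIntegral.integral_add (by simp) (Real.continuous_cos.intervalIntegrable _ _)]
    simp
  | succ h ih =>
    simp only [survivalKernel]
    rw [intervalIntegral.integral_add
      (((continuous_survivalKernel h).intervalIntegrable _ _).add (hc _)) (hc _),
      intervalIntegral.integral_add ((continuous_survivalKernel h).intervalIntegrable _ _) (hc _),
      ih, integral_cos_nat_mul (by omega), integral_cos_nat_mul (by omega)]
    simp

/-- The probability `U n h` that a lazy simple random walk on `ℤ` started from `h` stays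
nonnegative for `n` steps, as an integral. -/
theorem survival_eq_integral {p : ℝ} {U : ℕ → ℕ → ℝ} (h0 : ∀ h, U 0 h = 1)
    (hz : ∀ n, U (n + 1) 0 = p * U n 1 + (1 - 2 * p) * U n 0)
    (hs : ∀ n h, U (n + 1) (h + 1) =
      p * U n (h + 2) + p * U n h + (1 - 2 * p) * U n (h + 1)) (n h : ℕ) :
    U n h = Real.pi⁻¹ * ∫ t in (0 : ℝ)..Real.pi,
      survivalKernel h t * (1 - 2 * p * (1 - Real.cos t)) ^ n := by
  have hi : ∀ n h, IntervalIntegrable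
      (fun t => survivalKernel h t * (1 - 2 * p * (1 - Real.cos t)) ^ n) volume 0 Real.pi := by
    intro n h
    refine Continuous.intervalIntegrable ?_ _ _
    have := continuous_survivalKernel h
    fun_prop
  induction n generalizing h with
  | zero =>
    simp only [pow_zero, mul_one, integral_survivalKernel, h0]
    exact (inv_mul_cancel₀ Real.pi_ne_zero).symm
  -- One step of the walk acts on the kernel as multiplication by `2 * p * cos t + (1 - 2 * p)`,
  -- which is the base of the power.
  | succ n ih =>
    cases h with
    | zero =>
      rw [hz, ih, ih, mul_left_comm p, mul_left_comm (1 - 2 * p), ← mul_add,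
        ← intervalIntegral.integral_const_mul, ← intervalIntegral.integral_const_mul,
        ← intervalIntegral.integral_add ((hi _ _).const_mul _) ((hi _ _).const_mul _)]
      congr 2
      ext t
      have := two_mul_cos_mul_survivalKernel_zero t
      rw [pow_succ, ← this]
      ring
    | succ h =>
      rw [hs, ih, ih, ih, mul_left_comm p, mul_left_comm p, mul_left_comm (1 - 2 * p), ← mul_add,
        ← mul_add, ← intervalIntegral.integral_const_mul, ← intervalIntegral.integral_const_mul,
        ← intervalIntegral.integral_const_mul,
        ← intervalIntegral.integral_add ((hi _ _).const_mul _) ((hi _ _).const_mul _),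
        ← intervalIntegral.integral_add (((hi _ _).const_mul _).add ((hi _ _).const_mul _))
          ((hi _ _).const_mul _)]
      congr 2
      ext t
      have := two_mul_cos_mul_survivalKernel_succ h t
      rw [pow_succ]
      linear_combination (-p * (1 - 2 * p * (1 - Real.cos t)) ^ n) * this

/-! ### Laplace's method for the survival integral -/

theorem tendsto_mul_one_sub_cos_div_sqrt (u : ℝ) :
    Tendsto (fun n : ℕ => (n : ℝ) * (1 - Real.cos (u / √(n : ℝ)))) atTop (𝓝 (u ^ 2 / 2)) := by
  have hu : Tendsto (fun n : ℕ => u / √(n : ℝ)) atTop (𝓝 0) :=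
    tendsto_const_nhds.div_atTop (Real.tendsto_sqrt_atTop.comp tendsto_natCast_atTop_atTop)
  have hlim : Tendsto (fun n : ℕ => u ^ 4 * (5 / 96) / (n : ℝ)) atTop (𝓝 0) :=
    tendsto_const_nhds.div_atTop tendsto_natCast_atTop_atTop
  rw [tendsto_iff_norm_sub_tendsto_zero]
  refine squeeze_zero' (Eventually.of_forall fun _ => norm_nonneg _) ?_ hlim
  have h1 : ∀ᶠ n : ℕ in atTop, |u / √(n : ℝ)| ≤ 1 := by
    have := hu.abs
    rw [abs_zero] at this
    exact (this.eventually_lt_const one_pos).mono fun n hn => hn.le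
  filter_upwards [h1, eventually_gt_atTop 0] with n hn hpos
  have hn0 : (0 : ℝ) < n := by exact_mod_cast hpos
  have hb := Real.cos_bound hn
  have hsq : (u / √(n : ℝ)) ^ 2 = u ^ 2 / n := by rw [div_pow, Real.sq_sqrt hn0.le]
  have h4 : |u / √(n : ℝ)| ^ 4 = u ^ 4 / n ^ 2 := by
    rw [show |u / √(n : ℝ)| ^ 4 = (|u / √(n : ℝ)| ^ 2) ^ 2 by ring, sq_abs, hsq, div_pow]
    ring
  rw [hsq, h4] at hb
  have e : (n : ℝ) * (1 - Real.cos (u / √(n : ℝ))) - u ^ 2 / 2 =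
      -(n * (Real.cos (u / √(n : ℝ)) - (1 - u ^ 2 / n / 2))) := by
    field_simp
    ring
  rw [e, Real.norm_eq_abs, abs_neg, abs_mul, abs_of_pos hn0]
  calc (n : ℝ) * |Real.cos (u / √(n : ℝ)) - (1 - u ^ 2 / n / 2)|
      ≤ n * (u ^ 4 / n ^ 2 * (5 / 96)) := mul_le_mul_of_nonneg_left hb hn0.le
    _ = u ^ 4 * (5 / 96) / n := by field_simp

/-- Combine `(1 - x) ^ n * (1 + x) ^ n ≤ 1` with Bernoulli's `1 + n * x ≤ (1 + x) ^ n`. -/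
theorem mul_one_sub_pow_le {x : ℝ} (h0 : 0 ≤ x) (h1 : x ≤ 1) {n : ℕ} (hn : 0 < n) :
    x * (1 - x) ^ n ≤ 1 / n := by
  have hn' : (0 : ℝ) < n := by exact_mod_cast hn
  have hb := one_add_mul_le_pow (show (-2 : ℝ) ≤ x by linarith) n
  have hp : (1 - x) ^ n * (1 + x) ^ n ≤ 1 := by
    rw [← mul_pow]
    exact pow_le_one₀ (by nlinarith) (by nlinarith)
  have hq : 0 ≤ (1 - x) ^ n := pow_nonneg (by linarith) n
  rw [le_div_iff₀ hn']
  nlinarith [mul_le_mul_of_nonneg_left hb hq]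

/-- Laplace's method for the positive part of the integrand. -/
theorem tendsto_sqrt_mul_integral_posPart {p : ℝ} (hp : 0 < p) :
    Tendsto (fun n : ℕ => √(n : ℝ) * ∫ t in (0 : ℝ)..Real.pi,
      (1 + Real.cos t) * max (1 - 2 * p * (1 - Real.cos t)) 0 ^ n) atTop
      (𝓝 (√(Real.pi / p))) := by
  set f : ℕ → ℝ → ℝ := fun n t =>
    (1 + Real.cos t) * max (1 - 2 * p * (1 - Real.cos t)) 0 ^ n with hf
  have hfc : ∀ n, Continuous (f n) := fun n => by
    simp only [hf]
    fun_prop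
  -- Rescaling `t = u / √n`, extended by zero so that all integrals run over the half-line.
  set F : ℕ → ℝ → ℝ := fun n =>
    (Set.Iic (√(n : ℝ) * Real.pi)).indicator fun u => f n (u / √(n : ℝ)) with hF
  have hchange : ∀ n : ℕ, 0 < n → √(n : ℝ) * ∫ t in (0 : ℝ)..Real.pi, f n t =
      ∫ u in Set.Ioi (0 : ℝ), F n u := by
    intro n hn
    have hs : 0 < √(n : ℝ) := Real.sqrt_pos.2 (by exact_mod_cast hn)
    have h1 := intervalIntegral.integral_comp_div (a := 0) (b := √(n : ℝ) * Real.pi) (f n) hs.ne'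
    rw [zero_div, mul_div_cancel_left₀ _ hs.ne', smul_eq_mul] at h1
    rw [← h1, intervalIntegral.integral_of_le (by positivity), hF, setIntegral_indicator measurableSet_Iic]
    rfl
  -- The Gaussian majorant comes from `1 - cos t ≥ 2 * t ^ 2 / π ^ 2` on `[-π, π]`.
  have hcos : ∀ n : ℕ, 0 < n → ∀ u : ℝ, 0 < u → u ≤ √(n : ℝ) * Real.pi →
      |f n (u / √(n : ℝ))| ≤ 2 * Real.exp (-(4 * p / Real.pi ^ 2) * u ^ 2) := by
    intro n hn u hu hun
    have hn' : (0 : ℝ) < n := by exact_mod_cast hn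
    have hs : 0 < √(n : ℝ) := Real.sqrt_pos.2 hn'
    have hle : |u / √(n : ℝ)| ≤ Real.pi := by
      rw [abs_of_pos (by positivity), div_le_iff₀ hs, mul_comm]
      exact hun
    have hq := Real.cos_le_one_sub_mul_cos_sq hle
    rw [div_pow, Real.sq_sqrt hn'.le] at hq
    set t := u / √(n : ℝ)
    have hc1 := Real.neg_one_le_cos t
    have hc2 := Real.cos_le_one t
    have hm : max (1 - 2 * p * (1 - Real.cos t)) 0 ≤ Real.exp (-(2 * p * (1 - Real.cos t))) :=
      max_le (Real.one_sub_le_exp_neg _) (Real.exp_pos _).le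
    simp only [hf]
    rw [abs_of_nonneg (mul_nonneg (by linarith) (pow_nonneg (le_max_right _ _) _))]
    refine mul_le_mul (by linarith) ?_ (pow_nonneg (le_max_right _ _) _) zero_le_two
    refine (pow_le_pow_left₀ (le_max_right _ _) hm n).trans ?_
    rw [← Real.exp_nat_mul]
    refine Real.exp_le_exp.2 ?_
    have h3 : 2 / Real.pi ^ 2 * (u ^ 2 / n) ≤ 1 - Real.cos t := by linarith
    have h4 := mul_le_mul_of_nonneg_left h3 (show 0 ≤ n * (2 * p) by positivity)
    have h5 : n * (2 * p) * (2 / Real.pi ^ 2 * (u ^ 2 / n)) = 4 * p / Real.pi ^ 2 * u ^ 2 := by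
      field_simp
      ring
    linarith
  have hlim : ∀ u : ℝ, 0 < u →
      Tendsto (fun n => F n u) atTop (𝓝 (2 * Real.exp (-p * u ^ 2))) := by
    intro u hu
    have hsq : Tendsto (fun n : ℕ => √(n : ℝ)) atTop atTop :=
      Real.tendsto_sqrt_atTop.comp tendsto_natCast_atTop_atTop
    have ht : Tendsto (fun n : ℕ => u / √(n : ℝ)) atTop (𝓝 0) := tendsto_const_nhds.div_atTop hsq
    have hc : Tendsto (fun n : ℕ => Real.cos (u / √(n : ℝ))) atTop (𝓝 1) := by
      have := (Real.continuous_cos.tendsto 0).comp ht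
      rwa [Real.cos_zero] at this
    have h1 := (tendsto_mul_one_sub_cos_div_sqrt u).const_mul (-(2 * p))
    have h2 : Tendsto (fun n : ℕ => (1 + -(2 * p) * (1 - Real.cos (u / √(n : ℝ)))) ^ n) atTop
        (𝓝 (Real.exp (-p * u ^ 2))) := by
      refine Real.tendsto_one_add_pow_exp_of_tendsto ?_
      convert h1 using 2
      · ring
      · ring
    have h3 := (hc.const_add 1).mul h2
    rw [one_add_one_eq_two] at h3
    refine h3.congr' ?_
    have h4 : Tendsto (fun n : ℕ => 1 - 2 * p * (1 - Real.cos (u / √(n : ℝ)))) atTop (𝓝 1) := by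
      simpa using ((hc.const_sub 1).const_mul (2 * p)).const_sub 1
    filter_upwards [h4.eventually_const_lt one_pos,
      hsq.eventually_ge_atTop (u / Real.pi)] with n hn hn2
    have hmem : u ∈ Set.Iic (√(n : ℝ) * Real.pi) := (div_le_iff₀ Real.pi_pos).1 hn2
    simp only [hF, Set.indicator_of_mem hmem, hf, max_eq_left hn.le]
    ring
  have hgauss : ∫ u in Set.Ioi (0 : ℝ), 2 * Real.exp (-p * u ^ 2) = √(Real.pi / p) := by
    rw [integral_const_mul, integral_gaussian_Ioi]
    ring
  rw [← hgauss]
  have hdom : Tendsto (fun n => ∫ u in Set.Ioi (0 : ℝ), F (n + 1) u) atTop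
      (𝓝 (∫ u in Set.Ioi (0 : ℝ), 2 * Real.exp (-p * u ^ 2))) := by
    refine tendsto_integral_of_dominated_convergence
      (fun u => 2 * Real.exp (-(4 * p / Real.pi ^ 2) * u ^ 2)) ?_ ?_ ?_ ?_
    · intro n
      refine (Measurable.indicator ?_ measurableSet_Iic).aestronglyMeasurable
      exact ((hfc _).comp (continuous_id.div_const _)).measurable
    · exact ((integrable_exp_neg_mul_sq (by positivity)).const_mul 2).integrableOn
    · intro n
      filter_upwards [ae_restrict_mem measurableSet_Ioi] with u hu
      by_cases hmem : u ∈ Set.Iic (√((n + 1 : ℕ) : ℝ) * Real.pi)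
      · simp only [hF, Set.indicator_of_mem hmem]
        exact hcos (n + 1) n.succ_pos u hu hmem
      · simp only [hF, Set.indicator_of_notMem hmem, norm_zero]
        positivity
    · filter_upwards [ae_restrict_mem measurableSet_Ioi] with u hu
      exact (hlim u hu).comp (tendsto_add_atTop_nat 1)
  refine ((tendsto_add_atTop_iff_nat (f := fun n => ∫ u in Set.Ioi (0 : ℝ), F n u) 1).1
    hdom).congr' ?_
  filter_upwards [eventually_gt_atTop 0] with n hn
  exact (hchange n hn).symm

/-- For `p > 1 / 4` the base is negative near `t = π`, and for `p = 1 / 2` it reaches `-1` there.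
The factor `x = 1 + cos t` compensates: where the base is negative, `2 * p ≤ 1` bounds its absolute
value by `1 - x`, so the negative part contributes only `O(1 / n)`. -/
theorem tendsto_sqrt_mul_integral {p : ℝ} (hp : 0 < p) (hp' : p ≤ 1 / 2) :
    Tendsto (fun n : ℕ => √(n : ℝ) * ∫ t in (0 : ℝ)..Real.pi,
      (1 + Real.cos t) * (1 - 2 * p * (1 - Real.cos t)) ^ n) atTop (𝓝 (√(Real.pi / p))) := by
  have hneg : Tendsto (fun n : ℕ => √(n : ℝ) * ∫ t in (0 : ℝ)..Real.pi,
      (1 + Real.cos t) * min (1 - 2 * p * (1 - Real.cos t)) 0 ^ n) atTop (𝓝 0) := by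
    have hlim : Tendsto (fun n : ℕ => Real.pi / √(n : ℝ)) atTop (𝓝 0) :=
      tendsto_const_nhds.div_atTop (Real.tendsto_sqrt_atTop.comp tendsto_natCast_atTop_atTop)
    refine squeeze_zero_norm' ?_ hlim
    filter_upwards [eventually_gt_atTop 0] with n hn
    have hn' : (0 : ℝ) < n := by exact_mod_cast hn
    have hb : ‖∫ t in (0 : ℝ)..Real.pi,
        (1 + Real.cos t) * min (1 - 2 * p * (1 - Real.cos t)) 0 ^ n‖ ≤
        1 / n * |Real.pi - 0| := by
      refine intervalIntegral.norm_integral_le_of_norm_le_const fun t _ => ?_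
      have hc1 := Real.neg_one_le_cos t
      have hc2 := Real.cos_le_one t
      rw [norm_mul, norm_pow, Real.norm_of_nonneg (by linarith : 0 ≤ 1 + Real.cos t)]
      rcases le_total 0 (1 - 2 * p * (1 - Real.cos t)) with h | h
      · rw [min_eq_right h, norm_zero, zero_pow hn.ne', mul_zero]
        positivity
      · rw [min_eq_left h, Real.norm_of_nonpos h]
        have h1 : 2 * p * (1 - Real.cos t) ≤ 1 * (1 - Real.cos t) :=
          mul_le_mul_of_nonneg_right (by linarith) (by linarith)
        refine le_trans ?_ (mul_one_sub_pow_le (x := 1 + Real.cos t) (by linarith) (by linarith) hn)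
        refine mul_le_mul_of_nonneg_left ?_ (by linarith)
        exact pow_le_pow_left₀ (by linarith) (by linarith) n
    rw [norm_mul, Real.norm_of_nonneg (Real.sqrt_nonneg _)]
    refine (mul_le_mul_of_nonneg_left hb (Real.sqrt_nonneg _)).trans (le_of_eq ?_)
    have hs : √(n : ℝ) ≠ 0 := (Real.sqrt_pos.2 hn').ne'
    rw [sub_zero, abs_of_pos Real.pi_pos]
    nth_rewrite 2 [← Real.mul_self_sqrt hn'.le]
    field_simp
  have h := (tendsto_sqrt_mul_integral_posPart hp).add hneg
  rw [add_zero] at h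
  refine h.congr' ?_
  filter_upwards [eventually_gt_atTop 0] with n hn
  rw [← mul_add, ← intervalIntegral.integral_add
    (Continuous.intervalIntegrable (by fun_prop) _ _)
    (Continuous.intervalIntegrable (by fun_prop) _ _)]
  congr 2
  ext t
  rw [← mul_add]
  congr 1
  rcases le_total 0 (1 - 2 * p * (1 - Real.cos t)) with h | h
  · rw [max_eq_left h, min_eq_right h, zero_pow hn.ne', add_zero]
  · rw [max_eq_right h, min_eq_left h, zero_pow hn.ne', zero_add]

/-- The survival probability decays like a positive multiple of `n ^ (-1 / 2)`. -/
theorem tendsto_sqrt_mul_survival {p : ℝ} (hp : 0 < p) (hp' : p ≤ 1 / 2) {U : ℕ → ℕ → ℝ}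
    (h0 : ∀ h, U 0 h = 1) (hz : ∀ n, U (n + 1) 0 = p * U n 1 + (1 - 2 * p) * U n 0)
    (hs : ∀ n h, U (n + 1) (h + 1) =
      p * U n (h + 2) + p * U n h + (1 - 2 * p) * U n (h + 1)) :
    Tendsto (fun n : ℕ => √(n : ℝ) * U n 0) atTop (𝓝 (Real.pi⁻¹ * √(Real.pi / p))) := by
  refine ((tendsto_sqrt_mul_integral hp hp').const_mul Real.pi⁻¹).congr fun n => ?_
  rw [survival_eq_integral h0 hz hs, mul_left_comm]
  rfl

/-! ### Runs and restarts along a fixed sequence of steps -/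

section Deterministic

variable {S : Type*} (kind : S → MotzkinKind)

/-- The height after `k` steps of the walk driven by `w`, without any restart. -/
def walkHeight (w : ℕ → S) (k : ℕ) : ℤ := ∑ i ∈ Finset.range k, (kind (w i)).rise

/-- The walk driven by `w` and started from `h` stays nonnegative for `n` steps. -/
def StaysNonneg (h : ℤ) (n : ℕ) (w : ℕ → S) : Prop := ∀ k ≤ n, 0 ≤ h + walkHeight kind w k

/-- The sequence `w` without its first `m` terms. -/
def seqShift (m : ℕ) (w : ℕ → S) : ℕ → S := fun i => w (m + i)

theorem walkHeight_succ_left (w : ℕ → S) (k : ℕ) :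
    walkHeight kind w (k + 1) = (kind (w 0)).rise + walkHeight kind (seqShift 1 w) k := by
  simp only [walkHeight, seqShift, Finset.sum_range_succ', add_comm 1]
  ring

theorem staysNonneg_succ_iff {h : ℤ} (hh : 0 ≤ h) (n : ℕ) (w : ℕ → S) :
    StaysNonneg kind h (n + 1) w ↔
      StaysNonneg kind (h + (kind (w 0)).rise) n (seqShift 1 w) := by
  constructor
  · intro H k hk
    have := H (k + 1) (Nat.succ_le_succ hk)
    rwa [walkHeight_succ_left, ← add_assoc] at this
  · rintro H (_ | k) hk
    · simpa [walkHeight] using hh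
    · rw [walkHeight_succ_left, ← add_assoc]
      exact H k (Nat.le_of_succ_le_succ hk)

variable {kind}

theorem StaysNonneg.mono {h : ℤ} {m n : ℕ} {w : ℕ → S} (H : StaysNonneg kind h n w)
    (hmn : m ≤ n) : StaysNonneg kind h m w := fun k hk => H k (hk.trans hmn)

theorem not_staysNonneg_of_neg {h : ℤ} (hh : h < 0) (n : ℕ) (w : ℕ → S) :
    ¬ StaysNonneg kind h n w := fun H => by
  have := H 0 n.zero_le
  simp [walkHeight] at this
  omega

theorem pathHeight_map_range (w : ℕ → S) (m : ℕ) :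
    pathHeight kind ((List.range m).map w) = walkHeight kind w m := by
  induction m with
  | zero => simp [pathHeight, walkHeight]
  | succ m ih =>
    rw [walkHeight, Finset.sum_range_succ, ← walkHeight, ← ih]
    simp [pathHeight, List.range_succ]

theorem florentinePath_of_staysNonneg {w : ℕ → S} {n : ℕ} (H : StaysNonneg kind 0 n w) {m : ℕ}
    (hm : m ≤ n) : florentinePath kind w m = (List.range m).map w := by
  induction m with
  | zero => rfl
  | succ m ih =>
    have h := H (m + 1) hm
    rw [zero_add, ← pathHeight_map_range, List.range_succ, List.map_append, List.map_singleton] at h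
    rw [florentinePath, ih (by omega), if_pos h, List.range_succ, List.map_append]
    rfl

theorem florentinePath_eq_nil_of_fail {w : ℕ → S} {k : ℕ} (H : StaysNonneg kind 0 k w)
    (H' : ¬ StaysNonneg kind 0 (k + 1) w) : florentinePath kind w (k + 1) = [] := by
  have h : ¬ 0 ≤ walkHeight kind w (k + 1) := by
    intro h
    refine H' fun j hj => ?_
    rcases Nat.le_succ_iff.1 hj with hj | rfl
    · exact H j hj
    · simpa using h
  rw [← pathHeight_map_range, List.range_succ, List.map_append, List.map_singleton] at h
  rw [florentinePath, florentinePath_of_staysNonneg H le_rfl, if_neg h]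

/-- The current path is the whole state of the algorithm, so an empty path forgets the past. -/
theorem florentinePath_add {w : ℕ → S} {m : ℕ} (h : florentinePath kind w m = []) (j : ℕ) :
    florentinePath kind w (j + m) = florentinePath kind (seqShift m w) j := by
  induction j with
  | zero => rw [zero_add, h]; rfl
  | succ j ih =>
    rw [Nat.succ_add_eq_add_succ, Nat.add_succ, florentinePath, ih, florentinePath, seqShift,
      add_comm m j]

theorem length_florentinePath_of_staysNonneg {w : ℕ → S} {n : ℕ} (H : StaysNonneg kind 0 n w)
    {m : ℕ} (hm : m ≤ n) : (florentinePath kind w m).length = m := by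
  simp [florentinePath_of_staysNonneg H hm]

theorem florentineTerminates_of_staysNonneg {w : ℕ → S} {n : ℕ} (H : StaysNonneg kind 0 n w) :
    FlorentineTerminates kind w n := ⟨n, length_florentinePath_of_staysNonneg H le_rfl⟩

theorem florentineCost_of_staysNonneg {w : ℕ → S} {n : ℕ} (H : StaysNonneg kind 0 n w) :
    florentineCost kind w n = n := by
  refine le_antisymm (Nat.sInf_le (length_florentinePath_of_staysNonneg H le_rfl)) ?_
  refine le_csInf ⟨n, length_florentinePath_of_staysNonneg H le_rfl⟩ fun m hm => ?_
  by_contra! hlt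
  have := length_florentinePath_of_staysNonneg H hlt.le
  have hm' : (florentinePath kind w m).length = n := hm
  omega

theorem length_florentinePath_ne_of_fail {w : ℕ → S} {k n : ℕ} (hk : k < n)
    (H : StaysNonneg kind 0 k w) {m : ℕ} (hm : m < k + 1) :
    (florentinePath kind w m).length ≠ n := by
  rw [length_florentinePath_of_staysNonneg H (Nat.le_of_lt_succ hm)]
  omega

theorem florentineTerminates_iff_of_fail {w : ℕ → S} {k n : ℕ} (hk : k < n)
    (H : StaysNonneg kind 0 k w) (H' : ¬ StaysNonneg kind 0 (k + 1) w) :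
    FlorentineTerminates kind w n ↔ FlorentineTerminates kind (seqShift (k + 1) w) n := by
  have hadd := florentinePath_add (florentinePath_eq_nil_of_fail H H')
  constructor
  · rintro ⟨m, hm⟩
    have hle : k + 1 ≤ m := by
      by_contra! hlt
      exact length_florentinePath_ne_of_fail hk H hlt hm
    exact ⟨m - (k + 1), by rw [← hadd, Nat.sub_add_cancel hle, hm]⟩
  · rintro ⟨m, hm⟩
    exact ⟨m + (k + 1), by rw [hadd, hm]⟩

/-- Before the restart the length is at most `k < n`. Termination is needed: the default value `0`
on both sides would break the identity. -/
theorem florentineCost_of_fail {w : ℕ → S} {k n : ℕ} (hk : k < n)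
    (H : StaysNonneg kind 0 k w) (H' : ¬ StaysNonneg kind 0 (k + 1) w)
    (ht : FlorentineTerminates kind w n) :
    florentineCost kind w n = florentineCost kind (seqShift (k + 1) w) n + (k + 1) := by
  have hadd := florentinePath_add (florentinePath_eq_nil_of_fail H H')
  have hle : k + 1 ≤ sInf {m | (florentinePath kind w m).length = n} := by
    refine le_csInf ht fun m hm => ?_
    by_contra! hlt
    exact length_florentinePath_ne_of_fail hk H hlt hm
  rw [florentineCost, florentineCost, ← Nat.sInf_add hle]
  simp only [hadd]

theorem florentinePath_congr {w w' : ℕ → S} {m : ℕ} (h : ∀ i < m, w i = w' i) :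
    florentinePath kind w m = florentinePath kind w' m := by
  induction m with
  | zero => rfl
  | succ m ih =>
    rw [florentinePath, florentinePath, ih fun i hi => h i (by omega), h m (by omega)]

theorem staysNonneg_congr {w w' : ℕ → S} {a : ℤ} {n : ℕ} (h : ∀ i < n, w i = w' i) :
    StaysNonneg kind a n w ↔ StaysNonneg kind a n w' := by
  refine forall₂_congr fun k hk => ?_
  rw [walkHeight, walkHeight, Finset.sum_congr rfl fun i hi => by
    rw [h i ((Finset.mem_range.1 hi).trans_le hk)]]

end Deterministic

/-! ### Independence of the first steps from the later ones -/

section Splitting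

variable {S : Type*} [MeasurableSpace S]

theorem measurable_seqShift (m : ℕ) : Measurable (seqShift m : (ℕ → S) → ℕ → S) :=
  measurable_pi_lambda _ fun i => measurable_pi_apply (m + i)

/-- An event determined by `m` coordinates is the preimage of a subset of the finite space `Fin m →
S`, where every set is measurable. -/
theorem measurableSet_iSup_of_congr [Finite S] [MeasurableSingletonClass S] {m : ℕ}
    {A : Set (ℕ → S)} (hA : ∀ w w' : ℕ → S, (∀ i < m, w i = w' i) → (w ∈ A ↔ w' ∈ A)) :
    MeasurableSet[⨆ i ∈ Set.Iio m, MeasurableSpace.comap (fun w : ℕ → S => w i) inferInstance]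
      A := by
  let r : (ℕ → S) → Fin m → S := fun w i => w i
  have hr : Measurable[⨆ i ∈ Set.Iio m,
      MeasurableSpace.comap (fun w : ℕ → S => w i) inferInstance] r := by
    refine @measurable_pi_lambda _ _ _ (_) _ _ fun i => ?_
    refine Measurable.mono (comap_measurable fun w : ℕ → S => w i) ?_ le_rfl
    exact le_iSup₂_of_le (i : ℕ) i.2 le_rfl
  have hpre : A = r ⁻¹' (r '' A) := by
    refine (Set.subset_preimage_image r A).antisymm ?_
    rintro w ⟨w', hw', e⟩
    exact (hA w' w fun i hi => congr_fun e ⟨i, hi⟩).1 hw'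
  rw [hpre]
  exact hr (Set.toFinite _).measurableSet

theorem measurableSet_of_congr [Finite S] [MeasurableSingletonClass S] {m : ℕ}
    {A : Set (ℕ → S)} (hA : ∀ w w' : ℕ → S, (∀ i < m, w i = w' i) → (w ∈ A ↔ w' ∈ A)) :
    MeasurableSet A :=
  (iSup₂_le fun i _ => (measurable_pi_apply i).comap_le : _ ≤ MeasurableSpace.pi) A
    (measurableSet_iSup_of_congr hA)

theorem map_seqShift_infinitePi (ν : Measure S) [IsProbabilityMeasure ν] (m : ℕ) :
    (Measure.infinitePi fun _ : ℕ => ν).map (seqShift m) = Measure.infinitePi fun _ : ℕ => ν :=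
  Measure.map_infinitePi_infinitePi_of_inj (add_right_injective m)

/-- The first `m` terms of an i.i.d. sequence are independent of the remaining ones. -/
theorem infinitePi_inter_preimage_seqShift [Finite S] [MeasurableSingletonClass S]
    (ν : Measure S) [IsProbabilityMeasure ν] {m : ℕ} {A B : Set (ℕ → S)}
    (hA : ∀ w w' : ℕ → S, (∀ i < m, w i = w' i) → (w ∈ A ↔ w' ∈ A)) (hB : MeasurableSet B) :
    Measure.infinitePi (fun _ : ℕ => ν) (A ∩ seqShift m ⁻¹' B) =
      Measure.infinitePi (fun _ : ℕ => ν) A * Measure.infinitePi (fun _ : ℕ => ν) B := by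
  have h := (iIndepFun_infinitePi (P := fun _ : ℕ => ν) (X := fun _ => id)
    fun _ => measurable_id)
  have hI := indep_iSup_of_disjoint (fun i => (measurable_pi_apply i).comap_le) h
    (S := Set.Iio m) (T := Set.Ici m) (Set.Iio_disjoint_Ici le_rfl)
  have hs : Measurable[⨆ i ∈ Set.Ici m,
      MeasurableSpace.comap (fun w : ℕ → S => w i) inferInstance] (seqShift (S := S) m) := by
    refine @measurable_pi_lambda _ _ _ (_) _ _ fun i => ?_
    refine Measurable.mono (comap_measurable fun w : ℕ → S => w (m + i)) ?_ le_rfl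
    exact le_iSup₂_of_le (m + i) (Nat.le_add_right m i) le_rfl
  have h1 := (Indep_iff _ _ _).1 hI A _ (measurableSet_iSup_of_congr hA) (hs hB)
  rw [h1, ← Measure.map_apply (measurable_seqShift m) hB, map_seqShift_infinitePi]

end Splitting

/-! ### Survival probabilities and their recursion -/

section Survival

variable {S : Type*} [MeasurableSpace S] (kind : S → MotzkinKind) (ν : Measure S)

/-- The probability that the walk started from `h` stays nonnegative for `n` steps. -/
noncomputable def survivalProb (n : ℕ) (h : ℤ) : ℝ :=
  (Measure.infinitePi fun _ : ℕ => ν).real {w | StaysNonneg kind h n w}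

theorem survivalProb_zero [IsProbabilityMeasure ν] {h : ℤ} (hh : 0 ≤ h) : survivalProb kind ν 0 h = 1 := by
  have : {w : ℕ → S | StaysNonneg kind h 0 w} = Set.univ := by
    refine Set.eq_univ_of_forall fun w k hk => ?_
    rw [Nat.le_zero.1 hk]
    simpa [walkHeight] using hh
  rw [survivalProb, this]
  exact probReal_univ

theorem survivalProb_of_neg (n : ℕ) {h : ℤ} (hh : h < 0) : survivalProb kind ν n h = 0 := by
  have : {w : ℕ → S | StaysNonneg kind h n w} = ∅ :=
    Set.eq_empty_of_forall_notMem fun w => not_staysNonneg_of_neg hh n w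
  rw [survivalProb, this, measureReal_empty]

theorem survivalProb_nonneg (n : ℕ) (h : ℤ) : 0 ≤ survivalProb kind ν n h := measureReal_nonneg

end Survival

section SurvivalRecursion

variable {S : Type*} (kind : S → MotzkinKind)

/-- Taking the level value as a baseline avoids counting the level steps. -/
theorem sum_comp_kind [Fintype S] (f : MotzkinKind → ℝ) :
    ∑ s, f (kind s) = Fintype.card S * f .level +
      Fintype.card {s : S // kind s = MotzkinKind.up} * (f .up - f .level) +
      Fintype.card {s : S // kind s = MotzkinKind.down} * (f .down - f .level) := by
  have h : ∀ s, f (kind s) = f .level + (if kind s = .up then f .up - f .level else 0) +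
      (if kind s = .down then f .down - f .level else 0) := by
    intro s
    cases kind s <;> simp
  rw [Finset.sum_congr rfl fun s _ => h s, Finset.sum_add_distrib, Finset.sum_add_distrib,
    ← Finset.sum_filter, ← Finset.sum_filter]
  simp [Fintype.card_subtype, mul_sub]

theorem card_up_div_card_mem_Ioc [Fintype S]
    (h_up : 0 < Fintype.card {s : S // kind s = MotzkinKind.up})
    (h_eq : Fintype.card {s : S // kind s = MotzkinKind.up} =
      Fintype.card {s : S // kind s = MotzkinKind.down}) :
    (Fintype.card {s : S // kind s = MotzkinKind.up} / Fintype.card S : ℝ) ∈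
      Set.Ioc (0 : ℝ) (1 / 2) := by
  have hN : (0 : ℝ) < Fintype.card S := by
    have := h_up.trans_le (Fintype.card_subtype_le _)
    exact_mod_cast this
  have h1 : (0 : ℝ) < Fintype.card {s : S // kind s = MotzkinKind.up} := by exact_mod_cast h_up
  refine ⟨by positivity, ?_⟩
  have h := sum_comp_kind kind fun κ => if κ = .level then (1 : ℝ) else 0
  rw [← h_eq] at h
  have h2 : (0 : ℝ) ≤ ∑ s, if kind s = .level then (1 : ℝ) else 0 :=
    Finset.sum_nonneg fun s _ => by split_ifs <;> norm_num
  simp only [h, if_true, reduceCtorEq, if_false] at h2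
  rw [div_le_iff₀ hN]
  linarith

variable [MeasurableSpace S] [MeasurableSingletonClass S]

section Measurability

variable [Finite S]

theorem measurableSet_staysNonneg (h : ℤ) (n : ℕ) : MeasurableSet {w | StaysNonneg kind h n w} :=
  measurableSet_of_congr (m := n) fun _ _ hw => staysNonneg_congr hw

theorem measurableSet_length_florentinePath (m n : ℕ) :
    MeasurableSet {w | (florentinePath kind w m).length = n} :=
  measurableSet_of_congr (m := m) fun _ _ hw => by
    simp only [Set.mem_ofPred_eq, florentinePath_congr hw]

theorem measurableSet_florentineTerminates (n : ℕ) :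
    MeasurableSet {w | FlorentineTerminates kind w n} := by
  simp only [FlorentineTerminates, Set.ofPred_exists]
  exact MeasurableSet.iUnion fun m => measurableSet_length_florentinePath kind m n

theorem measurable_florentineCost (n : ℕ) : Measurable fun w => florentineCost kind w n := by
  classical
  -- The second alternative makes the search always succeed, returning `0` without termination, in
  -- agreement with `sInf ∅ = 0`.
  set E : (ℕ → S) → ℕ → Prop := fun w m =>
    (florentinePath kind w m).length = n ∨ ¬ FlorentineTerminates kind w n with hE
  have hex : ∀ w, ∃ m, E w m := by
    intro w
    by_cases h : FlorentineTerminates kind w n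
    · exact h.imp fun m hm => Or.inl hm
    · exact ⟨0, Or.inr h⟩
  have hfind : (fun w => florentineCost kind w n) = fun w => Nat.find (hex w) := by
    ext w
    refine ((Nat.find_eq_iff (hex w)).2 ?_).symm
    by_cases h : FlorentineTerminates kind w n
    · refine ⟨Or.inl (Nat.sInf_mem (s := {m | (florentinePath kind w m).length = n}) h), ?_⟩
      rintro m hm (h' | h')
      · exact Nat.notMem_of_lt_sInf hm h'
      · exact h' h
    · refine ⟨Or.inr h, fun m hm => ?_⟩
      have h0 : florentineCost kind w n = 0 := by
        have : {m | (florentinePath kind w m).length = n} = ∅ :=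
          Set.eq_empty_of_forall_notMem fun m hm => h ⟨m, hm⟩
        rw [florentineCost, this, Nat.sInf_empty]
      omega
  rw [hfind]
  refine measurable_find hex fun m => ?_
  exact (measurableSet_length_florentinePath kind m n).union
    (measurableSet_florentineTerminates kind n).compl

end Measurability

variable [Fintype S] (ν : Measure S) [IsProbabilityMeasure ν]

/-- Condition on the first step; the remaining sequence is an independent copy. -/
theorem survivalProb_succ_eq_sum (n : ℕ) {h : ℤ} (hh : 0 ≤ h) :
    survivalProb kind ν (n + 1) h =
      ∑ s, ν.real {s} * survivalProb kind ν n (h + (kind s).rise) := by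
  have hU : {w : ℕ → S | StaysNonneg kind h (n + 1) w} = ⋃ s ∈ (Finset.univ : Finset S),
      ({w | w 0 = s} ∩ seqShift 1 ⁻¹' {w | StaysNonneg kind (h + (kind s).rise) n w}) := by
    ext w
    simp [staysNonneg_succ_iff kind hh]
  have hcyl : ∀ s : S, Measure.infinitePi (fun _ : ℕ => ν) {w | w 0 = s} = ν {s} := by
    intro s
    have := Measure.infinitePi_map_eval (fun _ : ℕ => ν) 0
    conv_rhs => rw [← this]
    rw [Measure.map_apply (measurable_pi_apply 0) (measurableSet_singleton s)]
    rfl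
  have hmeas : ∀ s : S, MeasurableSet ({w : ℕ → S | w 0 = s} ∩
      seqShift 1 ⁻¹' {w | StaysNonneg kind (h + (kind s).rise) n w}) := fun s =>
    (measurableSet_of_congr (m := 1) fun w w' hw => by simp [hw 0 one_pos]).inter
      (measurable_seqShift 1 (measurableSet_staysNonneg kind _ n))
  rw [survivalProb, hU, measureReal_biUnion_finset _ fun s _ => hmeas s]
  · refine Finset.sum_congr rfl fun s _ => ?_
    rw [measureReal_def, infinitePi_inter_preimage_seqShift ν
      (fun w w' hw => by simp [hw 0 one_pos]) (measurableSet_staysNonneg kind _ n), hcyl,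
      ENNReal.toReal_mul]
    rfl
  · intro s _ s' _ hne
    refine Set.disjoint_left.2 fun w hw hw' => hne ?_
    exact hw.1.symm.trans hw'.1

variable {kind ν}

theorem survivalProb_succ {p : ℝ} (hν : ∀ s, ν.real {s} = (Fintype.card S : ℝ)⁻¹)
    (h_up : 0 < Fintype.card {s : S // kind s = MotzkinKind.up})
    (h_eq : Fintype.card {s : S // kind s = MotzkinKind.up} =
      Fintype.card {s : S // kind s = MotzkinKind.down})
    (hp : p = Fintype.card {s : S // kind s = MotzkinKind.up} / Fintype.card S)
    (n : ℕ) {h : ℤ} (hh : 0 ≤ h) :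
    survivalProb kind ν (n + 1) h = p * survivalProb kind ν n (h + 1) +
      p * survivalProb kind ν n (h - 1) + (1 - 2 * p) * survivalProb kind ν n h := by
  have hN : (Fintype.card S : ℝ) ≠ 0 := by
    have := h_up.trans_le (Fintype.card_subtype_le _)
    exact_mod_cast this.ne'
  rw [survivalProb_succ_eq_sum kind ν n hh]
  simp only [hν]
  rw [← Finset.mul_sum, sum_comp_kind kind fun κ => survivalProb kind ν n (h + κ.rise), ← h_eq, hp]
  simp only [MotzkinKind.rise, add_zero, ← sub_eq_add_neg]
  field_simp
  ring

end SurvivalRecursion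

/-! ### Almost sure termination and the renewal equation for the cost -/

section CostLaw

/-- The sequences for which the walk steps below the origin for the first time at step `k + 1`. -/
def failSet {S : Type*} (kind : S → MotzkinKind) (k : ℕ) : Set (ℕ → S) :=
  {w | StaysNonneg kind 0 k w ∧ ¬ StaysNonneg kind 0 (k + 1) w}

theorem failSet_congr {S : Type*} {kind : S → MotzkinKind} {k : ℕ} (w w' : ℕ → S)
    (h : ∀ i < k + 1, w i = w' i) : w ∈ failSet kind k ↔ w' ∈ failSet kind k :=
  and_congr (staysNonneg_congr fun i hi => h i (by omega)) (not_congr (staysNonneg_congr h))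

theorem antitone_survivalProb {S : Type*} [MeasurableSpace S] (kind : S → MotzkinKind)
    (ν : Measure S) [IsProbabilityMeasure ν] : Antitone fun n => survivalProb kind ν n 0 :=
  fun _ _ h => measureReal_mono fun _ hw => hw.mono h

variable {S : Type*} [Finite S] [MeasurableSpace S] [MeasurableSingletonClass S]
  (kind : S → MotzkinKind)

/-- Decomposition by the first failure time. Only the pieces need be measurable, not `E`. -/
theorem measure_eq_add_sum_failSet (μ : Measure (ℕ → S)) (E : Set (ℕ → S)) (n : ℕ) :
    μ E = μ (E ∩ {w | StaysNonneg kind 0 n w}) + ∑ k ∈ Finset.range n, μ (E ∩ failSet kind k) := by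
  induction n with
  | zero =>
    have : {w : ℕ → S | StaysNonneg kind 0 0 w} = Set.univ := by
      refine Set.eq_univ_of_forall fun w k hk => ?_
      rw [Nat.le_zero.1 hk]
      simp [walkHeight]
    simp [this]
  | succ n ih =>
    have h := measure_inter_add_sdiff (μ := μ) (E ∩ {w | StaysNonneg kind 0 n w})
      (measurableSet_staysNonneg kind 0 (n + 1))
    have h1 : E ∩ {w | StaysNonneg kind 0 n w} ∩ {w | StaysNonneg kind 0 (n + 1) w} =
        E ∩ {w | StaysNonneg kind 0 (n + 1) w} := by
      have hsub : {w : ℕ → S | StaysNonneg kind 0 (n + 1) w} ⊆ {w | StaysNonneg kind 0 n w} :=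
        fun w hw => hw.mono n.le_succ
      rw [Set.inter_assoc, Set.inter_eq_right.2 hsub]
    have h2 : (E ∩ {w | StaysNonneg kind 0 n w}) \ {w | StaysNonneg kind 0 (n + 1) w} =
        E ∩ failSet kind n := Set.inter_sdiff_assoc _ _ _
    rw [h1, h2] at h
    rw [ih, ← h, Finset.sum_range_succ]
    ring

variable (ν : Measure S) [IsProbabilityMeasure ν]

theorem measure_failSet (k : ℕ) : Measure.infinitePi (fun _ : ℕ => ν) (failSet kind k) =
    ENNReal.ofReal (survivalProb kind ν k 0 - survivalProb kind ν (k + 1) 0) := by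
  have h : failSet kind k = {w | StaysNonneg kind 0 k w} \ {w | StaysNonneg kind 0 (k + 1) w} := rfl
  have hsub : {w : ℕ → S | StaysNonneg kind 0 (k + 1) w} ⊆ {w | StaysNonneg kind 0 k w} :=
    fun w hw => hw.mono k.le_succ
  rw [survivalProb, survivalProb, ← measureReal_sdiff hsub
    (measurableSet_staysNonneg kind 0 (k + 1)), ← h, ofReal_measureReal]

variable {kind ν}

theorem ae_florentineTerminates {n : ℕ} (hq : 0 < survivalProb kind ν n 0) :
    ∀ᵐ w ∂Measure.infinitePi (fun _ : ℕ => ν), FlorentineTerminates kind w n := by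
  set μ := Measure.infinitePi fun _ : ℕ => ν with hμ
  set N : Set (ℕ → S) := {w | ¬ FlorentineTerminates kind w n} with hN
  have hNm : MeasurableSet N := (measurableSet_florentineTerminates kind n).compl
  have h1 := measure_eq_add_sum_failSet kind μ N n
  have h2 : N ∩ {w | StaysNonneg kind 0 n w} = ∅ :=
    Set.eq_empty_of_forall_notMem fun w hw => hw.1 (florentineTerminates_of_staysNonneg hw.2)
  have h3 : ∀ k ∈ Finset.range n, μ (N ∩ failSet kind k) = μ (failSet kind k) * μ N := by
    intro k hk
    rw [← infinitePi_inter_preimage_seqShift ν failSet_congr hNm, Set.inter_comm N]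
    congr 1
    ext w
    refine and_congr_right fun hw => not_congr ?_
    exact florentineTerminates_iff_of_fail (Finset.mem_range.1 hk) hw.1 hw.2
  rw [h2, measure_empty, zero_add, Finset.sum_congr rfl h3, ← Finset.sum_mul] at h1
  have h4 := measure_eq_add_sum_failSet kind μ Set.univ n
  simp only [Set.univ_inter, measure_univ] at h4
  change μ N = 0
  -- This is `μ N = (1 - q n) * μ N`, arranged without subtraction in `ℝ≥0∞`.
  have h5 : μ {w | StaysNonneg kind 0 n w} * μ N + μ N = 0 + μ N := by
    calc μ {w | StaysNonneg kind 0 n w} * μ N + μ N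
        = μ {w | StaysNonneg kind 0 n w} * μ N +
          (∑ k ∈ Finset.range n, μ (failSet kind k)) * μ N := by rw [← h1]
      _ = 0 + μ N := by rw [← add_mul, ← h4, one_mul, zero_add]
  have h6 := (ENNReal.add_left_inj (measure_ne_top μ N)).1 h5
  rcases mul_eq_zero.1 h6 with h | h
  · exact absurd (by rw [survivalProb, measureReal_def, ← hμ, h, ENNReal.toReal_zero]) hq.ne'
  · exact h

theorem map_florentineCost_eq {n : ℕ} (hq : 0 < survivalProb kind ν n 0) :
    (Measure.infinitePi fun _ : ℕ => ν).map (fun w => florentineCost kind w n) =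
      ENNReal.ofReal (survivalProb kind ν n 0) • Measure.dirac n +
      ∑ k ∈ Finset.range n,
        ENNReal.ofReal (survivalProb kind ν k 0 - survivalProb kind ν (k + 1) 0) •
        ((Measure.infinitePi fun _ : ℕ => ν).map fun w => florentineCost kind w n).map
          fun x => x + (k + 1) := by
  have hm := measurable_florentineCost kind n
  set μ := Measure.infinitePi fun _ : ℕ => ν with hμ
  have hae : ∀ᵐ w ∂μ, FlorentineTerminates kind w n := ae_florentineTerminates hq
  ext B hB
  rw [Measure.map_apply hm hB,
    measure_eq_add_sum_failSet kind μ ((fun w => florentineCost kind w n) ⁻¹' B) n,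
    Measure.add_apply, Measure.finsetSum_apply]
  congr 1
  · rw [Measure.smul_apply, smul_eq_mul, Measure.dirac_apply' n hB, survivalProb,
      ofReal_measureReal]
    by_cases hn : n ∈ B
    · rw [Set.indicator_of_mem hn, Pi.one_apply, mul_one, Set.inter_eq_right.2]
      intro w hw
      rwa [Set.mem_preimage, florentineCost_of_staysNonneg hw]
    · rw [Set.indicator_of_notMem hn, mul_zero, ← nonpos_iff_eq_zero, nonpos_iff_eq_zero]
      rw [show (fun w => florentineCost kind w n) ⁻¹' B ∩ {w | StaysNonneg kind 0 n w} = ∅ from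
        Set.eq_empty_of_forall_notMem fun w hw => hn ?_, measure_empty]
      have := hw.1
      rwa [Set.mem_preimage, florentineCost_of_staysNonneg hw.2] at this
  · refine Finset.sum_congr rfl fun k hk => ?_
    have hB' : MeasurableSet ((fun x => x + (k + 1)) ⁻¹' B) := MeasurableSet.of_discrete
    rw [Measure.smul_apply, smul_eq_mul, Measure.map_apply (Measurable.of_discrete) hB,
      Measure.map_apply hm hB', ← measure_failSet,
      ← infinitePi_inter_preimage_seqShift ν failSet_congr (hm hB')]
    -- The two events agree only off the null set of non-termination, where the cost takes its
    -- default value.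
    refine measure_congr ?_
    filter_upwards [hae] with w hw
    refine propext ?_
    change (florentineCost kind w n ∈ B ∧ w ∈ failSet kind k) ↔ (w ∈ failSet kind k ∧
      florentineCost kind (seqShift (k + 1) w) n + (k + 1) ∈ B)
    rw [and_comm]
    refine and_congr_right fun hf => ?_
    rw [florentineCost_of_fail (Finset.mem_range.1 hk) hf.1 hf.2 hw]

end CostLaw

/-! ### Moments and characteristic function of a renewal law -/

/-- The renewal equation satisfied by the law `ρ` of the time at which a run of length `n` is
completed, where a run fails after more than `k` steps with probability `q k`. -/
def IsRenewalLaw (q : ℕ → ℝ) (n : ℕ) (ρ : Measure ℕ) : Prop :=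
  ρ = ENNReal.ofReal (q n) • Measure.dirac n +
    ∑ k ∈ Finset.range n, ENNReal.ofReal (q k - q (k + 1)) • ρ.map fun x => x + (k + 1)

theorem sum_range_tail_sub {q : ℕ → ℝ} (h0 : q 0 = 1) (n : ℕ) :
    ∑ k ∈ Finset.range n, (q k - q (k + 1)) = 1 - q n := by
  rw [Finset.sum_range_sub', h0]

namespace IsRenewalLaw

variable {q : ℕ → ℝ} {n : ℕ} {ρ : Measure ℕ}

theorem integral_eq {E : Type*} [NormedAddCommGroup E] [NormedSpace ℝ E] [CompleteSpace E]
    (h : IsRenewalLaw q n ρ) (hanti : Antitone q) (hpos : 0 < q n) {G : ℕ → E}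
    (hG : ∀ d, Integrable (fun x => G (x + d)) ρ) :
    ∫ x, G x ∂ρ = q n • G n +
      ∑ k ∈ Finset.range n, (q k - q (k + 1)) • ∫ x, G (x + (k + 1)) ∂ρ := by
  have hi : ∀ k, Integrable G
      (ENNReal.ofReal (q k - q (k + 1)) • ρ.map fun x => x + (k + 1)) := fun k => by
    refine Integrable.smul_measure ?_ ENNReal.ofReal_ne_top
    rw [integrable_map_measure AEStronglyMeasurable.of_discrete
      Measurable.of_discrete.aemeasurable]
    exact hG (k + 1)
  conv_lhs => rw [h]
  rw [integral_add_measure ((integrable_dirac (by simp)).smul_measure ENNReal.ofReal_ne_top)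
      (integrable_finsetSum_measure.2 fun k _ => hi k),
    integral_smul_measure, integral_dirac, ENNReal.toReal_ofReal hpos.le,
    integral_finsetSum_measure fun k _ => hi k]
  congr 1
  refine Finset.sum_congr rfl fun k _ => ?_
  rw [integral_smul_measure, ENNReal.toReal_ofReal (sub_nonneg.2 (hanti k.le_succ)),
    integral_map Measurable.of_discrete.aemeasurable AEStronglyMeasurable.of_discrete]

variable [IsProbabilityMeasure ρ]

/-- The moment equations cannot be solved before finiteness is known, so truncate at `M`. The
inequality `(y + n) ^ 2 ≤ (1 + q n) * y ^ 2 + (1 + 1 / q n) * n ^ 2` makes the renewal equation a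
contraction of factor `(1 - q n) * (1 + q n) = 1 - q n ^ 2`. The resulting bound `K` does not depend
on `M`, and Fatou's lemma concludes. -/
theorem integrable_sq (h : IsRenewalLaw q n ρ) (h0 : q 0 = 1) (hanti : Antitone q)
    (hpos : 0 < q n) : Integrable (fun x : ℕ => (x : ℝ) ^ 2) ρ := by
  set f : ℕ → ℕ → ℝ := fun M x => (min x M : ℕ) ^ 2 with hf
  have hbd : ∀ M d, Integrable (fun x => f M (x + d)) ρ := by
    intro M d
    refine Integrable.of_bound AEStronglyMeasurable.of_discrete ((M : ℝ) ^ 2)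
      (Eventually.of_forall fun x => ?_)
    rw [Real.norm_of_nonneg (by positivity)]
    exact pow_le_pow_left₀ (Nat.cast_nonneg _) (Nat.cast_le.2 (min_le_right _ _)) 2
  have hw : ∀ k, 0 ≤ q k - q (k + 1) := fun k => sub_nonneg.2 (hanti k.le_succ)
  have hq1 : q n ≤ 1 := h0 ▸ hanti n.zero_le
  set K : ℝ := (n ^ 2 * q n + (1 + 1 / q n) * n ^ 2) / q n ^ 2 with hK
  have hle : ∀ M, ∫ x, f M x ∂ρ ≤ K := by
    intro M
    have hk : ∀ k ∈ Finset.range n, (q k - q (k + 1)) • ∫ x, f M (x + (k + 1)) ∂ρ ≤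
        (q k - q (k + 1)) * ((1 + q n) * ∫ x, f M x ∂ρ + (1 + 1 / q n) * n ^ 2) := by
      intro k hk
      refine mul_le_mul_of_nonneg_left ?_ (hw k)
      have hi0 : Integrable (fun x => (1 + q n) * f M x) ρ := (hbd M 0).const_mul (1 + q n)
      have hi := hi0.add (integrable_const ((1 + 1 / q n) * (n : ℝ) ^ 2))
      refine (integral_mono (hbd M (k + 1)) hi fun x => ?_).trans_eq ?_
      · have h1 : ((min (x + (k + 1)) M : ℕ) : ℝ) ≤ (min x M : ℕ) + (n : ℝ) := by
          have : min (x + (k + 1)) M ≤ min x M + n := by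
            have := Finset.mem_range.1 hk
            omega
          exact_mod_cast this
        simp only [hf, Pi.add_apply]
        refine (pow_le_pow_left₀ (Nat.cast_nonneg _) h1 2).trans ?_
        set y : ℝ := ((min x M : ℕ) : ℝ)
        have h2 : (1 + q n) * y ^ 2 + (1 + 1 / q n) * n ^ 2 - (y + n) ^ 2 =
            (q n * y - n) ^ 2 / q n := by
          field_simp
          ring
        have h3 : 0 ≤ (q n * y - n) ^ 2 / q n := by positivity
        linarith
      · simp only [Pi.add_apply]
        rw [integral_add hi0 (integrable_const _), integral_const_mul]
        simp
    have heq := h.integral_eq hanti hpos (hbd M)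
    have hsum := Finset.sum_le_sum hk
    rw [← Finset.sum_mul, sum_range_tail_sub h0] at hsum
    have hfn : q n • f M n ≤ n ^ 2 * q n := by
      rw [smul_eq_mul, mul_comm]
      refine mul_le_mul_of_nonneg_right ?_ hpos.le
      exact pow_le_pow_left₀ (Nat.cast_nonneg _) (Nat.cast_le.2 (min_le_left _ _)) 2
    rw [hK, le_div_iff₀ (by positivity)]
    have h4 : 0 ≤ q n * ((1 + 1 / q n) * (n : ℝ) ^ 2) := by positivity
    nlinarith
  refine ⟨AEStronglyMeasurable.of_discrete, lt_of_le_of_lt ?_ (ENNReal.ofReal_lt_top (r := K))⟩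
  have hlim : ∀ x : ℕ, Tendsto (fun M => ‖f M x‖ₑ) atTop (𝓝 ‖(x : ℝ) ^ 2‖ₑ) := by
    intro x
    refine tendsto_const_nhds.congr' ?_
    filter_upwards [eventually_ge_atTop x] with M hM
    simp only [hf, min_eq_left hM]
  calc ∫⁻ x : ℕ, ‖(x : ℝ) ^ 2‖ₑ ∂ρ
      = ∫⁻ x : ℕ, liminf (fun M => ‖f M x‖ₑ) atTop ∂ρ :=
        lintegral_congr fun x => (hlim x).liminf_eq.symm
    _ ≤ liminf (fun M => ∫⁻ x : ℕ, ‖f M x‖ₑ ∂ρ) atTop :=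
        lintegral_liminf_le fun M => Measurable.of_discrete
    _ ≤ ENNReal.ofReal K := by
        refine liminf_le_of_frequently_le' (Frequently.of_forall fun M => ?_)
        have h1 := ofReal_integral_norm_eq_lintegral_enorm (hbd M 0)
        simp only [add_zero] at h1
        rw [← h1]
        refine ENNReal.ofReal_le_ofReal (le_trans (le_of_eq ?_) (hle M))
        exact integral_congr_ae (Eventually.of_forall fun x => Real.norm_of_nonneg (by positivity))

theorem memLp_two (h : IsRenewalLaw q n ρ) (h0 : q 0 = 1) (hanti : Antitone q)
    (hpos : 0 < q n) : MemLp (fun x : ℕ => (x : ℝ)) 2 ρ :=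
  (memLp_two_iff_integrable_sq AEStronglyMeasurable.of_discrete).2 (h.integrable_sq h0 hanti hpos)

theorem integral_natCast (h : IsRenewalLaw q n ρ) (h0 : q 0 = 1) (hanti : Antitone q)
    (hpos : 0 < q n) : ∫ x : ℕ, (x : ℝ) ∂ρ =
      n + (∑ k ∈ Finset.range n, (q k - q (k + 1)) * ((k : ℝ) + 1)) / q n := by
  have hi : Integrable (fun x : ℕ => (x : ℝ)) ρ :=
    (h.memLp_two h0 hanti hpos).integrable one_le_two
  have heq := h.integral_eq hanti hpos (G := fun x : ℕ => (x : ℝ)) fun d => by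
    simpa using hi.add (integrable_const (d : ℝ))
  have hk : ∀ k ∈ Finset.range n, (q k - q (k + 1)) • ∫ x : ℕ, ((x + (k + 1) : ℕ) : ℝ) ∂ρ =
      (q k - q (k + 1)) * (∫ x : ℕ, (x : ℝ) ∂ρ) + (q k - q (k + 1)) * ((k : ℝ) + 1) := by
    intro k _
    push_cast
    rw [integral_add hi (integrable_const _), smul_eq_mul, mul_add]
    simp
  rw [Finset.sum_congr rfl hk, Finset.sum_add_distrib, ← Finset.sum_mul, sum_range_tail_sub h0,
    smul_eq_mul] at heq
  field_simp
  linarith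

/-- With `A`, `B` the first and second truncated moments over `q n`, the mean is `n + A` and the
second moment is `n ^ 2 + 2 * A * (n + A) + B`. -/
theorem variance_natCast (h : IsRenewalLaw q n ρ) (h0 : q 0 = 1) (hanti : Antitone q)
    (hpos : 0 < q n) : variance (fun x : ℕ => (x : ℝ)) ρ =
      ((∑ k ∈ Finset.range n, (q k - q (k + 1)) * ((k : ℝ) + 1)) / q n) ^ 2 +
      (∑ k ∈ Finset.range n, (q k - q (k + 1)) * ((k : ℝ) + 1) ^ 2) / q n := by
  have hL := h.memLp_two h0 hanti hpos
  have hi : Integrable (fun x : ℕ => (x : ℝ)) ρ := hL.integrable one_le_two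
  have hi2 := h.integrable_sq h0 hanti hpos
  have hexp : ∀ d : ℕ, (fun x : ℕ => ((x + d : ℕ) : ℝ) ^ 2) =
      fun x : ℕ => ((x : ℝ) ^ 2 + 2 * d * x) + (d : ℝ) ^ 2 := by
    intro d
    ext x
    push_cast
    ring
  have hid : ∀ d : ℕ, Integrable (fun x : ℕ => (x : ℝ) ^ 2 + 2 * d * x) ρ := fun d =>
    hi2.add (hi.const_mul _)
  have heq := h.integral_eq hanti hpos (G := fun x : ℕ => (x : ℝ) ^ 2) fun d => by
    rw [hexp d]
    exact (hid d).add (integrable_const _)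
  have hk : ∀ k ∈ Finset.range n, (q k - q (k + 1)) • ∫ x : ℕ, ((x + (k + 1) : ℕ) : ℝ) ^ 2 ∂ρ =
      (q k - q (k + 1)) * (∫ x : ℕ, (x : ℝ) ^ 2 ∂ρ) +
      ((q k - q (k + 1)) * ((k : ℝ) + 1)) * (2 * ∫ x : ℕ, (x : ℝ) ∂ρ) +
      (q k - q (k + 1)) * ((k : ℝ) + 1) ^ 2 := by
    intro k _
    rw [hexp, integral_add (hid _) (integrable_const _), integral_add hi2 (hi.const_mul _),
      integral_const_mul, integral_const, probReal_univ, smul_eq_mul, smul_eq_mul]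
    push_cast
    ring
  rw [Finset.sum_congr rfl hk, Finset.sum_add_distrib, Finset.sum_add_distrib, ← Finset.sum_mul,
    ← Finset.sum_mul, sum_range_tail_sub h0, smul_eq_mul] at heq
  rw [variance_eq_sub hL]
  have h1 := h.integral_natCast h0 hanti hpos
  set a := ∑ k ∈ Finset.range n, (q k - q (k + 1)) * ((k : ℝ) + 1)
  set b := ∑ k ∈ Finset.range n, (q k - q (k + 1)) * ((k : ℝ) + 1) ^ 2
  have h2 : ∫ x : ℕ, (x : ℝ) ^ 2 ∂ρ = n ^ 2 + 2 * (a / q n) * (∫ x : ℕ, (x : ℝ) ∂ρ) + b / q n := by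
    field_simp
    linarith
  simp only [Pi.pow_apply]
  rw [h2, h1]
  ring

/-- The renewal equation tested against a character, divided by `q n`. As a product, the identity
itself shows that the second factor is nonzero. -/
theorem integral_exp_mul_eq (h : IsRenewalLaw q n ρ) (h0 : q 0 = 1) (hanti : Antitone q)
    (hpos : 0 < q n) (t : ℝ) :
    (∫ x : ℕ, Complex.exp (Complex.I * t * x) ∂ρ) *
      (1 - (∑ k ∈ Finset.range n, ((q k - q (k + 1) : ℝ) : ℂ) *
        (Complex.exp (Complex.I * t * ((k : ℝ) + 1 : ℝ)) - 1)) / (q n : ℂ)) =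
      Complex.exp (Complex.I * t * n) := by
  have hi : ∀ d : ℕ, Integrable (fun x : ℕ => Complex.exp (Complex.I * t * (x + d : ℕ))) ρ := by
    intro d
    refine Integrable.of_bound AEStronglyMeasurable.of_discrete 1 (Eventually.of_forall fun x => ?_)
    rw [show Complex.I * t * ((x + d : ℕ) : ℂ) = ((t * (x + d : ℕ) : ℝ) : ℂ) * Complex.I by
      push_cast; ring, Complex.norm_exp_ofReal_mul_I]
  have heq := h.integral_eq hanti hpos
    (G := fun x : ℕ => Complex.exp (Complex.I * t * x)) hi
  have hk : ∀ k ∈ Finset.range n,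
      (q k - q (k + 1)) • ∫ x : ℕ, Complex.exp (Complex.I * t * (x + (k + 1) : ℕ)) ∂ρ =
      ((q k - q (k + 1) : ℝ) : ℂ) * Complex.exp (Complex.I * t * ((k : ℝ) + 1 : ℝ)) *
        ∫ x : ℕ, Complex.exp (Complex.I * t * x) ∂ρ := by
    intro k _
    rw [Complex.real_smul, mul_assoc]
    congr 1
    rw [← integral_const_mul]
    refine integral_congr_ae (Eventually.of_forall fun x => ?_)
    beta_reduce
    rw [← Complex.exp_add]
    congr 1
    push_cast
    ring
  rw [Finset.sum_congr rfl hk, ← Finset.sum_mul, Complex.real_smul] at heq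
  have hs : (∑ k ∈ Finset.range n, ((q k - q (k + 1) : ℝ) : ℂ)) = 1 - (q n : ℂ) := by
    rw [← Complex.ofReal_sum, sum_range_tail_sub h0]
    push_cast
    rfl
  simp only [mul_sub, mul_one, Finset.sum_sub_distrib, hs]
  have hq : (q n : ℂ) ≠ 0 := by exact_mod_cast hpos.ne'
  field_simp
  linear_combination heq

end IsRenewalLaw

/-! ### Weak convergence from characteristic functions -/

/-- A pointwise limit of characteristic functions that is continuous at `0` is a characteristic
function. -/
theorem exists_tendsto_of_tendsto_charFun {μ : ℕ → ProbabilityMeasure ℝ} {f : ℝ → ℂ}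
    (hf : ContinuousAt f 0)
    (h : ∀ t, Tendsto (fun n => charFun (μ n : Measure ℝ) t) atTop (𝓝 (f t))) :
    ∃ μ₀ : ProbabilityMeasure ℝ, (∀ t, charFun (μ₀ : Measure ℝ) t = f t) ∧
      Tendsto μ atTop (𝓝 μ₀) := by
  have htight : IsTightMeasureSet (Set.range fun n => (μ n : Measure ℝ)) :=
    isTightMeasureSet_of_tendsto_charFun hf h
  have hcomp : IsCompact (closure (Set.range μ)) := by
    refine isCompact_closure_of_isTightMeasureSet ?_
    convert htight using 1
    ext ρ
    simp
  -- Prokhorov gives a cluster point; its characteristic function must be `f`, and convergence of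
  -- the whole sequence follows.
  obtain ⟨μ₀, -, hμ₀⟩ := hcomp.exists_mapClusterPt (f := atTop) (u := μ)
    (tendsto_principal.2 (Eventually.of_forall fun n => subset_closure ⟨n, rfl⟩))
  have hchar : ∀ t, charFun (μ₀ : Measure ℝ) t = f t := by
    intro t
    obtain ⟨u, hu, hu'⟩ := mapClusterPt_iff_ultrafilter.1 hμ₀
    have h1 : Tendsto (fun n => charFun (μ n : Measure ℝ) t) u (𝓝 (charFun (μ₀ : Measure ℝ) t)) := by
      rw [ProbabilityMeasure.tendsto_iff_forall_integral_rclike_tendsto ℂ] at hu'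
      simp_rw [charFun_eq_integral_innerProbChar]
      exact hu' _
    exact tendsto_nhds_unique h1 ((h t).mono_left hu)
  exact ⟨μ₀, hchar, ProbabilityMeasure.tendsto_of_tendsto_charFun fun t => by
    rw [hchar]
    exact h t⟩

/-- The coefficients are at most `1`, so the series is bounded by `exp |s| - 1`. Continuity at `0`
is all that tightness requires. -/
theorem continuousAt_darlingMandelbrotCharFun :
    ContinuousAt (darlingMandelbrotCharFun (1 / 2)) 0 := by
  set g : ℝ → ℂ := fun s => ∑' n : ℕ, ((1 / 2 : ℝ) : ℂ) / (((n + 1 : ℕ) : ℂ) - ((1 / 2 : ℝ) : ℂ)) *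
    ((Complex.I * s) ^ (n + 1) / ((n + 1).factorial : ℂ)) with hg
  have hcoef : ∀ n : ℕ, ‖((1 / 2 : ℝ) : ℂ) / (((n + 1 : ℕ) : ℂ) - ((1 / 2 : ℝ) : ℂ))‖ ≤ 1 := by
    intro n
    have e : ((1 / 2 : ℝ) : ℂ) / (((n + 1 : ℕ) : ℂ) - ((1 / 2 : ℝ) : ℂ)) =
        (((1 / 2) / (((n + 1 : ℕ) : ℝ) - 1 / 2) : ℝ) : ℂ) := by
      push_cast
      rfl
    have hn := n.cast_nonneg (α := ℝ)
    have hpos : (0 : ℝ) < ((n + 1 : ℕ) : ℝ) - 1 / 2 := by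
      push_cast
      linarith
    rw [e, Complex.norm_real, Real.norm_of_nonneg (by positivity), div_le_one hpos]
    push_cast
    linarith
  have hbound : ∀ s, ‖g s‖ ≤ Real.exp |s| - 1 := by
    intro s
    have hsum : HasSum (fun n : ℕ => |s| ^ (n + 1) / ((n + 1).factorial : ℝ))
        (Real.exp |s| - 1) := by
      have h := NormedSpace.expSeries_div_hasSum_exp |s|
      rw [← Real.exp_eq_exp_ℝ] at h
      simpa using (hasSum_nat_add_iff' 1).2 h
    refine tsum_of_norm_bounded hsum fun n => ?_
    rw [norm_mul, norm_div (_ ^ _), norm_pow, norm_mul, Complex.norm_I, one_mul, Complex.norm_real,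
      Complex.norm_natCast, Real.norm_eq_abs]
    exact mul_le_of_le_one_left (by positivity) (hcoef n)
  have hg0 : g 0 = 0 := norm_le_zero_iff.1 ((hbound 0).trans_eq (by simp))
  have hgc : Tendsto g (𝓝 0) (𝓝 0) := by
    have hc : Continuous fun s : ℝ => Real.exp |s| - 1 := by fun_prop
    refine squeeze_zero_norm hbound ?_
    simpa using hc.tendsto 0
  have hf : darlingMandelbrotCharFun (1 / 2) = fun s => (1 - g s)⁻¹ := by
    ext s
    rfl
  rw [hf, ContinuousAt, hg0]
  exact (hgc.const_sub 1).inv₀ (by simp)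

theorem le_florentineCost {S : Type*} {kind : S → MotzkinKind} {w : ℕ → S} {n : ℕ}
    (h : FlorentineTerminates kind w n) : n ≤ florentineCost kind w n := by
  have hlen : ∀ m, (florentinePath kind w m).length ≤ m := by
    intro m
    induction m with
    | zero => exact le_rfl
    | succ m ih =>
      rw [florentinePath]
      split_ifs
      · simpa using ih
      · exact Nat.zero_le _
  exact le_csInf h fun m hm => (show (florentinePath kind w m).length = n from hm) ▸ hlen m

/-! ### Asymptotics of the renewal laws -/

namespace IsRenewalLaw

variable {q : ℕ → ℝ} {c : ℝ} {ρ : ℕ → Measure ℕ} [∀ n, IsProbabilityMeasure (ρ n)]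

theorem isEquivalent_integral (h : ∀ n, IsRenewalLaw q n (ρ n)) (h0 : q 0 = 1)
    (hanti : Antitone q) (hpos : ∀ n, 0 < q n) (hc : 0 < c)
    (hq : Tendsto (fun n : ℕ => √(n : ℝ) * q n) atTop (𝓝 c)) :
    (fun n : ℕ => ∫ x : ℕ, (x : ℝ) ∂ρ n) ~[atTop] fun n : ℕ => 2 * (n : ℝ) := by
  refine (Asymptotics.isEquivalent_iff_tendsto_one ?_).2 ?_
  · filter_upwards [eventually_gt_atTop 0] with n hn
    have : (n : ℝ) ≠ 0 := by exact_mod_cast hn.ne'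
    positivity
  have h1 := ((tendsto_truncated_moment hc hq one_ne_zero).const_add 1).div_const 2
  norm_num at h1
  refine h1.congr' ?_
  filter_upwards [eventually_gt_atTop 0] with n hn
  have hn' : (n : ℝ) ≠ 0 := by exact_mod_cast hn.ne'
  have hq' := (hpos n).ne'
  rw [Pi.div_apply, (h n).integral_natCast h0 hanti (hpos n)]
  simp only [mul_div_assoc', ← Finset.sum_div]
  field_simp

theorem isEquivalent_variance (h : ∀ n, IsRenewalLaw q n (ρ n)) (h0 : q 0 = 1)
    (hanti : Antitone q) (hpos : ∀ n, 0 < q n) (hc : 0 < c)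
    (hq : Tendsto (fun n : ℕ => √(n : ℝ) * q n) atTop (𝓝 c)) :
    (fun n : ℕ => variance (fun x : ℕ => (x : ℝ)) (ρ n)) ~[atTop]
      fun n : ℕ => 4 / 3 * (n : ℝ) ^ 2 := by
  refine (Asymptotics.isEquivalent_iff_tendsto_one ?_).2 ?_
  · filter_upwards [eventually_gt_atTop 0] with n hn
    have : (n : ℝ) ≠ 0 := by exact_mod_cast hn.ne'
    positivity
  -- The limit is `3 / 4 * (1 ^ 2 + 1 / 3) = 1`.
  have h1 := (((tendsto_truncated_moment hc hq one_ne_zero).pow 2).add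
    (tendsto_truncated_moment hc hq two_ne_zero)).const_mul (3 / 4)
  norm_num at h1
  refine h1.congr' ?_
  filter_upwards [eventually_gt_atTop 0] with n hn
  have hn' : (n : ℝ) ≠ 0 := by exact_mod_cast hn.ne'
  have hq' := (hpos n).ne'
  rw [Pi.div_apply, (h n).variance_natCast h0 hanti (hpos n)]
  simp only [div_pow, mul_div_assoc', ← Finset.sum_div]
  field_simp

/-- Take `t = s / n`; the shift by `-1` cancels the factor `exp (i s)` of the final successful run.
-/
theorem charFun_map_div_sub_one_mul (h : ∀ n, IsRenewalLaw q n (ρ n)) (h0 : q 0 = 1)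
    (hanti : Antitone q) (hpos : ∀ n, 0 < q n) {n : ℕ} (hn : n ≠ 0) (s : ℝ) :
    charFun ((ρ n).map fun x : ℕ => (x : ℝ) / n - 1) s *
      (1 - (∑ k ∈ Finset.range n, ((q k - q (k + 1) : ℝ) : ℂ) *
        (Complex.exp (Complex.I * s * (((k : ℝ) + 1) / n : ℝ)) - 1)) / (q n : ℂ)) = 1 := by
  have hn' : (n : ℂ) ≠ 0 := by exact_mod_cast hn
  have h1 := (h n).integral_exp_mul_eq h0 hanti (hpos n) (s / n)
  have e1 : ∀ k : ℕ, Complex.I * ((s / n : ℝ) : ℂ) * (((k : ℝ) + 1 : ℝ) : ℂ) =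
      Complex.I * s * (((k : ℝ) + 1) / n : ℝ) := by
    intro k
    push_cast
    field_simp
  have e2 : Complex.I * ((s / n : ℝ) : ℂ) * n = Complex.I * s := by
    push_cast
    field_simp
  simp only [e1] at h1
  rw [e2] at h1
  have h2 : charFun ((ρ n).map fun x : ℕ => (x : ℝ) / n - 1) s =
      Complex.exp (-(Complex.I * s)) *
        ∫ x : ℕ, Complex.exp (Complex.I * ((s / n : ℝ) : ℂ) * x) ∂ρ n := by
    rw [charFun_apply_real, integral_map Measurable.of_discrete.aemeasurable (by fun_prop),
      ← integral_const_mul]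
    refine integral_congr_ae (Eventually.of_forall fun x => ?_)
    beta_reduce
    rw [← Complex.exp_add]
    congr 1
    push_cast
    ring
  rw [h2, mul_assoc, h1, ← Complex.exp_add, neg_add_cancel, Complex.exp_zero]

theorem tendsto_charFun_map_div_sub_one (h : ∀ n, IsRenewalLaw q n (ρ n)) (h0 : q 0 = 1)
    (hanti : Antitone q) (hpos : ∀ n, 0 < q n) (hc : 0 < c)
    (hq : Tendsto (fun n : ℕ => √(n : ℝ) * q n) atTop (𝓝 c)) (s : ℝ) :
    Tendsto (fun n : ℕ => charFun ((ρ n).map fun x : ℕ => (x : ℝ) / n - 1) s) atTop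
      (𝓝 (darlingMandelbrotCharFun (1 / 2) s)) := by
  have hlim := tendsto_truncated_charFun hc hq hpos hanti s
  have hev : ∀ᶠ n : ℕ in atTop, charFun ((ρ n).map fun x : ℕ => (x : ℝ) / n - 1) s =
      (1 - (∑ k ∈ Finset.range n, ((q k - q (k + 1) : ℝ) : ℂ) *
        (Complex.exp (Complex.I * s * (((k : ℝ) + 1) / n : ℝ)) - 1)) / (q n : ℂ))⁻¹ := by
    filter_upwards [eventually_ne_atTop 0] with n hn
    exact eq_inv_of_mul_eq_one_left (charFun_map_div_sub_one_mul h h0 hanti hpos hn s)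
  -- Each prelimit denominator is the inverse of a characteristic function, so its norm is at least
  -- `1`; this bound survives in the limit.
  have hne : (1 - ∑' n : ℕ, ((1 / 2 : ℝ) : ℂ) / (((n + 1 : ℕ) : ℂ) - ((1 / 2 : ℝ) : ℂ)) *
      ((Complex.I * s) ^ (n + 1) / ((n + 1).factorial : ℂ))) ≠ 0 := by
    refine norm_pos_iff.1 ?_
    refine (zero_lt_one (α := ℝ)).trans_le (ge_of_tendsto hlim.norm ?_)
    filter_upwards [eventually_ne_atTop 0] with n hn
    have hφ := congrArg (fun z : ℂ => ‖z‖) (charFun_map_div_sub_one_mul h h0 hanti hpos hn s)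
    have : IsProbabilityMeasure ((ρ n).map fun x : ℕ => (x : ℝ) / n - 1) :=
      Measure.isProbabilityMeasure_map Measurable.of_discrete.aemeasurable
    have hle := norm_charFun_le_one (μ := (ρ n).map fun x : ℕ => (x : ℝ) / n - 1) s
    simp only [norm_mul, norm_one] at hφ
    exact hφ.symm.le.trans (mul_le_of_le_one_left (norm_nonneg _) hle)
  exact (hlim.inv₀ hne).congr' (hev.mono fun n hn => hn.symm)

end IsRenewalLaw

namespace IsRenewalLaw

variable {q : ℕ → ℝ} {c : ℝ} {ρ : ℕ → Measure ℕ} [∀ n, IsProbabilityMeasure (ρ n)]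

/-- The law of the completion time, divided by `n` and shifted by `-1`, converges weakly to the
Darling–Mandelbrot distribution of parameter `1 / 2`. -/
theorem exists_tendsto_isDarlingMandelbrot (h : ∀ n, IsRenewalLaw q n (ρ n)) (h0 : q 0 = 1)
    (hanti : Antitone q) (hpos : ∀ n, 0 < q n) (hc : 0 < c)
    (hq : Tendsto (fun n : ℕ => √(n : ℝ) * q n) atTop (𝓝 c))
    (hge : ∀ n, ∀ᵐ x ∂ρ n, n ≤ x) {κ : ℕ → ProbabilityMeasure ℝ}
    (hκ : ∀ n, (κ n : Measure ℝ) = (ρ n).map fun x : ℕ => (x : ℝ) / n - 1) :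
    ∃ μ : ProbabilityMeasure ℝ, IsDarlingMandelbrot (1 / 2) μ ∧ Tendsto κ atTop (𝓝 μ) := by
  obtain ⟨μ, hμ, hlim⟩ := exists_tendsto_of_tendsto_charFun (μ := κ)
    continuousAt_darlingMandelbrotCharFun fun t => by
      simp only [hκ]
      exact tendsto_charFun_map_div_sub_one h h0 hanti hpos hc hq t
  refine ⟨μ, ⟨?_, hμ⟩, hlim⟩
  -- Portmanteau: the cost is at least `n`, so the rescaled laws do not charge the open set `Iio 0`.
  have hle := ProbabilityMeasure.le_liminf_measure_open_of_tendsto hlim (isOpen_Iio (a := (0 : ℝ)))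
  have hzero : (fun n => (κ n : Measure ℝ) (Set.Iio 0)) =ᶠ[atTop] fun _ => 0 := by
    filter_upwards [eventually_gt_atTop 0] with n hn
    rw [hκ, Measure.map_apply Measurable.of_discrete measurableSet_Iio]
    refine measure_mono_null (fun x hx => ?_) (hge n)
    have hn' : (0 : ℝ) < n := by exact_mod_cast hn
    have hx' : (x : ℝ) / n - 1 < 0 := hx
    rw [sub_neg, div_lt_one hn', Nat.cast_lt] at hx'
    exact not_le.2 hx'
  rw [liminf_congr hzero, liminf_const] at hle
  exact le_antisymm hle zero_le

end IsRenewalLaw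

/-! ### Assembly for independent uniform steps -/

theorem proposition1 {S : Type*} [Fintype S] [MeasurableSpace S] [MeasurableSingletonClass S]
    (kind : S → MotzkinKind)
    (h_up : 0 < Fintype.card {s : S // kind s = MotzkinKind.up})
    (h_eq : Fintype.card {s : S // kind s = MotzkinKind.up} =
      Fintype.card {s : S // kind s = MotzkinKind.down})
    {Ω : Type*} [MeasurableSpace Ω] (P : Measure Ω) [IsProbabilityMeasure P]
    (ξ : ℕ → Ω → S) (h_meas : ∀ i, Measurable (ξ i)) (h_indep : iIndepFun ξ P)
    (h_unif : ∀ i s, P {ω | ξ i ω = s} = (Fintype.card S : ℝ≥0∞)⁻¹)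
    (Y : ℕ → Ω → ℝ)
    (hY : ∀ n ω, Y n ω = (florentineCost kind (fun i => ξ i ω) n : ℝ)) :
    (∀ᵐ ω ∂P, ∀ n, FlorentineTerminates kind (fun i => ξ i ω) n) ∧
    (∃ ν : ProbabilityMeasure ℝ, IsShiftedDarlingMandelbrot (1 / 2) ν ∧
      TendstoInDistribution (fun (n : ℕ) (ω : Ω) => Y n ω / (n : ℝ)) atTop (fun x : ℝ => x)
        (fun _ => P) (ν : Measure ℝ)) ∧
    (∀ n, MemLp (Y n) 2 P) ∧
    (fun n : ℕ => ∫ ω, Y n ω ∂P) ~[atTop] (fun n : ℕ => 2 * (n : ℝ)) ∧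
    (fun n : ℕ => variance (Y n) P) ~[atTop] (fun n : ℕ => 4 / 3 * (n : ℝ) ^ 2) := by
  -- the common law of the steps, and the law of the sequence of steps
  set ν : Measure S := P.map (ξ 0) with hν
  have hprob : IsProbabilityMeasure ν := Measure.isProbabilityMeasure_map (h_meas 0).aemeasurable
  have hlaw : ∀ i s, P.map (ξ i) {s} = (Fintype.card S : ℝ≥0∞)⁻¹ := fun i s => by
    rw [Measure.map_apply (h_meas i) (measurableSet_singleton s), ← h_unif i s]
    rfl
  have hνs : ∀ s, ν.real {s} = (Fintype.card S : ℝ)⁻¹ := fun s => by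
    rw [measureReal_def, hν, hlaw, ENNReal.toReal_inv, ENNReal.toReal_natCast]
  have hX : Measurable fun ω i => ξ i ω := measurable_pi_lambda _ h_meas
  have hmap : P.map (fun ω i => ξ i ω) = Measure.infinitePi fun _ : ℕ => ν := by
    rw [(iIndepFun_iff_map_fun_eq_infinitePi_map h_meas).1 h_indep]
    congr 1
    ext1 i
    refine Measure.ext_of_singleton fun s => ?_
    rw [hlaw, hν, hlaw]
  -- the survival probabilities
  set p : ℝ := Fintype.card {s : S // kind s = MotzkinKind.up} / Fintype.card S with hp
  obtain ⟨hp0, hp1⟩ : p ∈ Set.Ioc (0 : ℝ) (1 / 2) := card_up_div_card_mem_Ioc kind h_up h_eq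
  have hrec : ∀ n {h : ℤ}, 0 ≤ h → survivalProb kind ν (n + 1) h =
      p * survivalProb kind ν n (h + 1) + p * survivalProb kind ν n (h - 1) +
        (1 - 2 * p) * survivalProb kind ν n h := fun n h hh =>
    survivalProb_succ hνs h_up h_eq hp n hh
  set q : ℕ → ℝ := fun n => survivalProb kind ν n 0 with hqdef
  -- An up step has positive probability, so the induction must cover all starting heights.
  have hpos' : ∀ n {h : ℤ}, 0 ≤ h → 0 < survivalProb kind ν n h := by
    intro n
    induction n with
    | zero =>
      intro h hh
      rw [survivalProb_zero kind ν hh]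
      exact one_pos
    | succ n ih =>
      intro h hh
      rw [hrec n hh]
      have h1 := mul_pos hp0 (ih (show 0 ≤ h + 1 by omega))
      have h2 := mul_nonneg hp0.le (survivalProb_nonneg kind ν n (h - 1))
      have h3 := mul_nonneg (show 0 ≤ 1 - 2 * p by linarith) (survivalProb_nonneg kind ν n h)
      linarith
  have h0 : q 0 = 1 := survivalProb_zero kind ν le_rfl
  have hanti : Antitone q := antitone_survivalProb kind ν
  have hpos : ∀ n, 0 < q n := fun n => hpos' n le_rfl
  have hc : 0 < Real.pi⁻¹ * √(Real.pi / p) := by positivity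
  have hq : Tendsto (fun n : ℕ => √(n : ℝ) * q n) atTop (𝓝 (Real.pi⁻¹ * √(Real.pi / p))) := by
    refine tendsto_sqrt_mul_survival hp0 hp1 (U := fun n h => survivalProb kind ν n (h : ℤ))
      (fun h => survivalProb_zero kind ν (Int.natCast_nonneg h)) (fun n => ?_) fun n h => ?_
    · have hneg : survivalProb kind ν n (0 - 1) = 0 := survivalProb_of_neg kind ν n (by norm_num)
      rw [Nat.cast_zero, hrec n le_rfl, hneg, mul_zero, add_zero]
      rfl
    · rw [hrec n (Int.natCast_nonneg _)]
      congr 4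
      push_cast
      ring
  -- the law of the cost
  set Z : ℕ → Ω → ℕ := fun n ω => florentineCost kind (fun i => ξ i ω) n with hZ
  have hZm : ∀ n, Measurable (Z n) := fun n => (measurable_florentineCost kind n).comp hX
  set ρ : ℕ → Measure ℕ := fun n => P.map (Z n) with hρ
  have hρprob : ∀ n, IsProbabilityMeasure (ρ n) := fun n =>
    Measure.isProbabilityMeasure_map (hZm n).aemeasurable
  have hρeq : ∀ n, ρ n =
      (Measure.infinitePi fun _ : ℕ => ν).map fun w => florentineCost kind w n := fun n => by
    rw [← hmap, Measure.map_map (measurable_florentineCost kind n) hX]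
    rfl
  have hren : ∀ n, IsRenewalLaw q n (ρ n) := fun n => by
    rw [IsRenewalLaw, hρeq]
    exact map_florentineCost_eq (hpos n)
  have hterm : ∀ n, ∀ᵐ ω ∂P, FlorentineTerminates kind (fun i => ξ i ω) n := fun n => by
    have := ae_florentineTerminates (kind := kind) (ν := ν) (hpos n)
    rw [← hmap] at this
    exact ae_of_ae_map hX.aemeasurable this
  have hge : ∀ n, ∀ᵐ x ∂ρ n, n ≤ x := fun n => by
    rw [hρ, ae_map_iff (hZm n).aemeasurable MeasurableSet.of_discrete]
    exact (hterm n).mono fun ω hω => le_florentineCost hω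
  have hYZ : ∀ n, Y n = (fun x : ℕ => (x : ℝ)) ∘ Z n := fun n => funext fun ω => hY n ω
  have hYm : ∀ n, Measurable (Y n) := fun n => by
    rw [hYZ]
    exact Measurable.of_discrete.comp (hZm n)
  refine ⟨ae_all_iff.2 hterm, ?_, fun n => ?_, ?_, ?_⟩
  · let κ : ℕ → ProbabilityMeasure ℝ := fun n => ⟨(ρ n).map fun x : ℕ => (x : ℝ) / n - 1,
      Measure.isProbabilityMeasure_map Measurable.of_discrete.aemeasurable⟩
    obtain ⟨μ, hμ, hlim⟩ := IsRenewalLaw.exists_tendsto_isDarlingMandelbrot hren h0 hanti hpos hc hq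
      hge (κ := κ) fun n => rfl
    have hcont : Continuous fun x : ℝ => x + 1 := by fun_prop
    refine ⟨μ.map hcont.measurable.aemeasurable, ⟨μ, hμ, rfl⟩,
      fun n => ((hYm n).div_const _).aemeasurable, aemeasurable_id', ?_⟩
    -- The shift by one is restored by continuous mapping.
    have h1 := ProbabilityMeasure.tendsto_map_of_tendsto_of_continuous _ _ hlim hcont
    refine (h1.congr fun n => Subtype.ext ?_).trans_eq ?_
    · change ((P.map (Z n)).map fun x : ℕ => (x : ℝ) / n - 1).map (fun x => x + 1) =
        P.map fun ω => Y n ω / n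
      rw [Measure.map_map hcont.measurable Measurable.of_discrete,
        Measure.map_map Measurable.of_discrete (hZm n)]
      congr 1
      ext ω
      simp [hY, hZ]
    · exact congrArg 𝓝 (Subtype.ext Measure.map_id.symm)
  · rw [hYZ]
    exact ((hren n).memLp_two h0 hanti (hpos n)).comp_of_map (hZm n).aemeasurable
  · refine (IsRenewalLaw.isEquivalent_integral hren h0 hanti hpos hc hq).congr_left ?_
    refine Eventually.of_forall fun n => ?_
    simp only [hYZ]
    exact integral_map (hZm n).aemeasurable AEStronglyMeasurable.of_discrete
  · refine (IsRenewalLaw.isEquivalent_variance hren h0 hanti hpos hc hq).congr_left ?_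
    refine Eventually.of_forall fun n => ?_
    simp only [hYZ]
    exact variance_map Measurable.of_discrete.aemeasurable (hZm n).aemeasurable
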